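/- \textbf{Finitely connected Galois categories.} Let $\mathsf{FSets}$ be the category of finite sets. A \emph{finitely connected Galois category} is an (essentially small) category $\mathcal C$ together with a set of functors $\{\mathcal F_i:\mathcal C\to\mathsf{FSets}\}_{i\in I}$ such that: $\mathcal C$ has finite limits and finite colimits; every morphism $u:Y\to X$ factors as $Y\xrightarrow{u'}X'\xrightarrow{u''}X$ with $u'$ a strict epimorphism (an epimorphism that is the coequaliser of the two projections $Y\times_{X'}Y\rightrightarrows Y$) and $u''$ a monomorphism that is the inclusion of a direct summand, i.e. $X\cong X'\sqcup X''$ for some $X''$, with $u''$ the first inclusion; every $\mathcal F_i$ preserves finite limits and finite colimits; and there is a finite subset $I_0\subseteq I$ such that a morphism $u$ of $\mathcal C$ is an isomorphism if and only if $\mathcal F_i(u)$ is an isomorphism for all $i\in I_0$. These form a 2-category $\mathsf{GCat}$. A morphism $(\mathcal C,\{\mathcal F_i\}_{i\in I})\to(\mathcal D,\{\mathcal G_j\}_{j\in J})$ is a triple $(f,\varphi,\lambda)$ of a map $f:J\to I$, a functor $\varphi:\mathcal C\to\mathcal D$ preserving finite limits and finite colimits, and natural isomorphisms $\lambda_j:\mathcal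 F_{f(j)}\to\mathcal G_j\circ\varphi$ $(j\in J)$. A 2-morphism $(f,\varphi,\lambda)\to(f',\varphi',\lambda')$ is a natural transformation $\zeta:\varphi\to\varphi'$ together with natural transformations $\theta_j:\mathcal F_{f(j)}\to\mathcal F_{f'(j)}$ $(j\in J)$ such that $\mathcal G_j(\zeta_x)\circ\lambda_j(x)=\lambda'_j(x)\circ\theta_j(x)$ for all $j\in J$ and $x\in\mathcal C$ (so the $\theta_j$ are determined by $\zeta$, and every natural transformation $\zeta:\varphi\to\varphi'$ occurs). Compositions are the evident ones. \textbf{Finitely connected profinite groupoids.} A \emph{finitely connected profinite groupoid} is a small groupoid $\mathfrak G$ whose sets $\mathrm{Hom}(a,b)$ carry profinite topologies for which composition and inversion are continuous, and which is equivalent (compatibly with the topologies) to a coproduct of finitely many one-object groupoids given by profinite groups. With continuous functors as morphisms and natural transformations as 2-morphisms these form a 2-category. Write $\mathfrak G\text{-}\mathsf{FSets}$ for the category of functors $X:\mathfrak G\to\mathsf{FSets}$ such that all maps $\mathrm{Hom}(a,b)\to\mathrm{Map}(X(a),X(b))$ are continuous, the targets being discrete. \textbf{Theorem.} The 2-category $\mathsf{GCat}$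 of finitely connected Galois categories is contravariantly 2-equivalent to the 2-category of finitely connected profinite groupoids. More precisely: for every finitely connected profinite groupoid $\mathfrak G$, the category $\mathfrak G\text{-}\mathsf{FSets}$ with the evaluation functors $\{\mathrm{ev}_x\}_{x\in\mathrm{Ob}\,\mathfrak G}$ is a finitely connected Galois category; for every continuous functor $A:\mathfrak G\to\mathfrak H$, the functor $A^*:\mathfrak H\text{-}\mathsf{FSets}\to\mathfrak G\text{-}\mathsf{FSets}$, $X\mapsto X\circ A$, preserves finite limits and finite colimits; and the 2-functor, contravariant on 1-morphisms, given by $\mathfrak G\mapsto(\mathfrak G\text{-}\mathsf{FSets},\{\mathrm{ev}_x\})$, by $A\mapsto(A|_{\mathrm{Ob}},A^*,\mathrm{id})$ on continuous functors, and by composition on natural transformations, is a 2-equivalence: every finitely connected Galois category is equivalent in $\mathsf{GCat}$ to one of the form $\mathfrak G\text{-}\mathsf{FSets}$, and for all $\mathfrak G,\mathfrak H$ the induced functor $\mathrm{Hom}(\mathfrak G,\mathfrak H)\to\mathrm{Hom}_{\mathsf{GCat}}(\mathfrak H\text{-}\mathsf{FSets},\mathfrak G\text{-}\mathsf{FSets})$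 is an equivalence of categories. -/

import Mathlib

open CategoryTheory CategoryTheory.Limits

universe u v w w₁ w₂ v₁ v₂ u₁ u₂

noncomputable section

/-! ### 2-equivalences -/

/-- A pseudofunctor is a 2-equivalence (biequivalence) if it is essentially surjective and fully
faithful in the 2-categorical sense: every object of the target is equivalent to one in the image,
and all functors between hom-categories are equivalences of categories. -/
structure CategoryTheory.Pseudofunctor.IsTwoEquivalence
    {B : Type u₁} [Bicategory.{w₁, v₁} B] {C : Type u₂} [Bicategory.{w₂, v₂} C]
    (Φ : Pseudofunctor B C) : Prop where
  essSurj : ∀ c : C, ∃ b : B, Nonempty (Bicategory.Equivalence (Φ.obj b) c)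
  fullyFaithful : ∀ a b : B, (Φ.mapFunctor a b).IsEquivalence

namespace FinConnGalois

/-! ### Finitely connected Galois categories -/

/-- A strict epimorphism: an epimorphism `p : A ⟶ B` whose pullback along itself exists and which
is the coequaliser of the two projections `A ×_B A ⇉ A`. -/
def IsStrictEpi {C : Type v} [Category.{w} C] {A B : C} (p : A ⟶ B) : Prop :=
  Epi p ∧ ∃ (P : C) (p₁ p₂ : P ⟶ A) (h : IsPullback p₁ p₂ p p),
    Nonempty (IsColimit (Cofork.ofπ p h.w))

/-- The axioms of a finitely connected Galois category `(C, {F j}_{j ∈ J})`. -/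
structure IsGalois {C : Type v} [Category.{w} C] {J : Type u₁}
    (F : J → C ⥤ FintypeCat.{u}) : Prop where
  hasFiniteLimits : HasFiniteLimits C
  hasFiniteColimits : HasFiniteColimits C
  /-- Every morphism is a strict epimorphism followed by the inclusion of a direct summand. -/
  factorisation : ∀ {Y X : C} (p : Y ⟶ X), ∃ (X' : C) (p' : Y ⟶ X') (p'' : X' ⟶ X),
    p' ≫ p'' = p ∧ IsStrictEpi p' ∧ Mono p'' ∧
      ∃ (X'' : C) (q : X'' ⟶ X), Nonempty (IsColimit (BinaryCofan.mk p'' q))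
  rightExact : ∀ j, PreservesFiniteColimits (F j)
  leftExact : ∀ j, PreservesFiniteLimits (F j)
  /-- Finitely many of the functors are jointly conservative. -/
  conservative : ∃ I : Finset J, ∀ {Y X : C} (p : Y ⟶ X),
    IsIso p ↔ ∀ i ∈ I, IsIso ((F i).map p)

end FinConnGalois

open FinConnGalois

/-- A finitely connected Galois category: an (essentially small) category with a set of functors to
finite sets satisfying the axioms `FinConnGalois.IsGalois`. -/
structure GCat : Type (u + 2) where
  /-- the underlying category -/
  C : Type (u + 1)
  [cat : Category.{u} C]
  essentiallySmall : EssentiallySmall.{u} C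
  /-- the index set of the fibre functors -/
  J : Type u
  /-- the fibre functors -/
  F : J → C ⥤ FintypeCat.{u}
  isGalois : IsGalois F

namespace GCat

attribute [instance] GCat.cat

/-- A morphism `(C, {F i}) ⟶ (D, {G j})` of Galois categories: a map `f : J ⟶ I` of index sets, an
exact functor `φ : C ⥤ D`, and natural isomorphisms `F (f j) ≅ φ ⋙ G j`. -/
structure Hom (X Y : GCat.{u}) : Type (u + 1) where
  f : Y.J → X.J
  φ : X.C ⥤ Y.C
  preservesFiniteLimits : PreservesFiniteLimits φ
  preservesFiniteColimits : PreservesFiniteColimits φ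
  lam : ∀ j, X.F (f j) ≅ φ ⋙ Y.F j

/-- The identity morphism. -/
def Hom.id (X : GCat.{u}) : Hom X X where
  f := fun j => j
  φ := 𝟭 X.C
  preservesFiniteLimits := inferInstance
  preservesFiniteColimits := inferInstance
  lam j := (Functor.leftUnitor (X.F j)).symm

/-- Composition of morphisms of Galois categories. -/
def Hom.comp {X Y Z : GCat.{u}} (p : Hom X Y) (q : Hom Y Z) : Hom X Z where
  f := fun k => p.f (q.f k)
  φ := p.φ ⋙ q.φ
  preservesFiniteLimits :=
    have := p.preservesFiniteLimits
    have := q.preservesFiniteLimits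
    comp_preservesFiniteLimits p.φ q.φ
  preservesFiniteColimits :=
    have := p.preservesFiniteColimits
    have := q.preservesFiniteColimits
    comp_preservesFiniteColimits p.φ q.φ
  lam k := p.lam (q.f k) ≪≫ Functor.isoWhiskerLeft p.φ (q.lam k) ≪≫
    (Functor.associator p.φ q.φ (Z.F k)).symm

/-- A 2-morphism `(f, φ, λ) ⟶ (f', φ', λ')`: a natural transformation `ζ : φ ⟶ φ'` which is
compatible with `λ` and `λ'`, where the fibre functors `F (f j)` and `F (f' j)` at which the two
morphisms are based are compared by `θ j`. -/
structure Hom₂ {X Y : GCat.{u}} (p q : Hom X Y) : Type (u + 1) where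
  ζ : p.φ ⟶ q.φ
  θ : ∀ j, X.F (p.f j) ⟶ X.F (q.f j)
  comm : ∀ j, (p.lam j).hom ≫ Functor.whiskerRight ζ (Y.F j) = θ j ≫ (q.lam j).hom

/-- The comparisons `θ` are determined by `ζ`. -/
theorem Hom₂.ext_ζ {X Y : GCat.{u}} {p q : Hom X Y} {a b : Hom₂ p q} (h : a.ζ = b.ζ) : a = b := by
  have hθ : a.θ = b.θ := by
    funext j
    rw [← cancel_mono (q.lam j).hom, ← a.comm, ← b.comm, h]
  cases a
  cases b
  simp_all

/-- The 2-morphism with a given underlying natural transformation; there is exactly one. -/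
def Hom₂.ofNatTrans {X Y : GCat.{u}} {p q : Hom X Y} (ζ : p.φ ⟶ q.φ) : Hom₂ p q where
  ζ := ζ
  θ j := (p.lam j).hom ≫ Functor.whiskerRight ζ (Y.F j) ≫ (q.lam j).inv
  comm j := by simp

instance homCategory (X Y : GCat.{u}) : Category.{u + 1} (Hom X Y) where
  Hom p q := Hom₂ p q
  id p := { ζ := 𝟙 p.φ, θ := fun j => 𝟙 (X.F (p.f j)), comm := fun j => by simp }
  comp a b :=
    { ζ := a.ζ ≫ b.ζ
      θ := fun j => a.θ j ≫ b.θ j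
      comm := fun j => by
        rw [Functor.whiskerRight_comp, ← Category.assoc, a.comm, Category.assoc, b.comm,
          Category.assoc] }
  id_comp a := Hom₂.ext_ζ (Category.id_comp a.ζ)
  comp_id a := Hom₂.ext_ζ (Category.comp_id a.ζ)
  assoc a b c := Hom₂.ext_ζ (Category.assoc a.ζ b.ζ c.ζ)

/-- An invertible 2-morphism from a natural isomorphism. -/
def isoOfNatIso {X Y : GCat.{u}} {p q : Hom X Y} (e : p.φ ≅ q.φ) : p ≅ q where
  hom := Hom₂.ofNatTrans e.hom
  inv := Hom₂.ofNatTrans e.inv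
  hom_inv_id := Hom₂.ext_ζ e.hom_inv_id
  inv_hom_id := Hom₂.ext_ζ e.inv_hom_id

/-- The 2-category of finitely connected Galois categories. -/
instance bicategory : Bicategory.{u + 1, u + 1} GCat.{u} where
  Hom X Y := Hom X Y
  id X := Hom.id X
  comp p q := Hom.comp p q
  homCategory X Y := homCategory X Y
  whiskerLeft p _ _ a := Hom₂.ofNatTrans (Functor.whiskerLeft (Hom.φ p) (Hom₂.ζ a))
  whiskerRight a r := Hom₂.ofNatTrans (Functor.whiskerRight (Hom₂.ζ a) (Hom.φ r))
  associator p q r := isoOfNatIso (p := (p.comp q).comp r) (q := p.comp (q.comp r))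
    (Functor.associator p.φ q.φ r.φ)
  leftUnitor {X Y} p := isoOfNatIso (p := (Hom.id X).comp p) (q := p) (Functor.leftUnitor p.φ)
  rightUnitor {X Y} p := isoOfNatIso (p := p.comp (Hom.id Y)) (q := p) (Functor.rightUnitor p.φ)
  whiskerLeft_id p q := Hom₂.ext_ζ (Functor.whiskerLeft_id p.φ)
  whiskerLeft_comp p _ _ _ a b :=
    Hom₂.ext_ζ (Functor.whiskerLeft_comp p.φ (Hom₂.ζ a) (Hom₂.ζ b))
  id_whiskerLeft a := by
    apply Hom₂.ext_ζ; apply NatTrans.ext; funext x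
    exact ((Category.id_comp _).trans (Category.comp_id _)).symm
  comp_whiskerLeft p q _ _ a := by
    apply Hom₂.ext_ζ; apply NatTrans.ext; funext x
    exact ((Category.id_comp _).trans (Category.comp_id _)).symm
  id_whiskerRight p q := Hom₂.ext_ζ (Functor.whiskerRight_id q.φ)
  comp_whiskerRight a b r := Hom₂.ext_ζ (Functor.whiskerRight_comp (Hom₂.ζ a) (Hom₂.ζ b) r.φ)
  whiskerRight_id a := by
    apply Hom₂.ext_ζ; apply NatTrans.ext; funext x
    exact ((Category.id_comp _).trans (Category.comp_id _)).symm
  whiskerRight_comp a q r := by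
    apply Hom₂.ext_ζ; apply NatTrans.ext; funext x
    exact ((Category.id_comp _).trans (Category.comp_id _)).symm
  whisker_assoc p _ _ a r := by
    apply Hom₂.ext_ζ; apply NatTrans.ext; funext x
    exact ((Category.id_comp _).trans (Category.comp_id _)).symm
  whisker_exchange a b := by
    apply Hom₂.ext_ζ; apply NatTrans.ext; funext x
    exact ((Hom₂.ζ b).naturality ((Hom₂.ζ a).app x)).symm
  pentagon p q r s := Hom₂.ext_ζ (Functor.pentagon p.φ q.φ r.φ s.φ)
  triangle p q := Hom₂.ext_ζ (Functor.triangle p.φ q.φ)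

end GCat

/-! ### Finitely connected profinite groupoids -/

/-- A finitely connected profinite groupoid: a groupoid whose hom-sets carry profinite topologies
(compact, Hausdorff and totally disconnected) with continuous composition and inversion, and which
is equivalent to the coproduct of finitely many one-object groupoids given by profinite groups. -/
structure ProfGrpd : Type (u + 1) where
  /-- the underlying groupoid -/
  obj : Type u
  [grpd : Groupoid.{u} obj]
  [top : ∀ x y : obj, TopologicalSpace (x ⟶ y)]
  compact : ∀ x y : obj, CompactSpace (x ⟶ y)
  hausdorff : ∀ x y : obj, T2Space (x ⟶ y)
  totallyDisconnected : ∀ x y : obj, TotallyDisconnectedSpace (x ⟶ y)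
  continuous_comp : ∀ x y z : obj, Continuous fun g : (x ⟶ y) × (y ⟶ z) => g.1 ≫ g.2
  continuous_inv : ∀ x y : obj, Continuous fun g : x ⟶ y => Groupoid.inv g
  /-- Each profinite group `G i` maps continuously (hence homeomorphically) onto the automorphism
  group of the corresponding object. -/
  finitelyConnected : ∃ (n : ℕ) (G : Fin n → ProfiniteGrp.{u})
    (e : (Σ i, SingleObj (G i)) ≌ obj), ∀ i, Continuous fun g : G i =>
      e.functor.map (Sigma.SigmaHom.mk (SingleObj.toEnd (G i) g))

namespace ProfGrpd

attribute [instance] ProfGrpd.grpd ProfGrpd.top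

/-- Continuous functors. -/
def isContinuous (𝔊 ℌ : ProfGrpd.{u}) : ObjectProperty (𝔊.obj ⥤ ℌ.obj) := fun A =>
  ∀ x y, Continuous fun g : x ⟶ y => A.map g

/-- Morphisms are continuous functors and 2-morphisms are all natural transformations. -/
abbrev Hom (𝔊 ℌ : ProfGrpd.{u}) : Type u := (isContinuous 𝔊 ℌ).FullSubcategory

/-- The identity functor. -/
def Hom.id (𝔊 : ProfGrpd.{u}) : Hom 𝔊 𝔊 :=
  ⟨𝟭 𝔊.obj, fun _ _ => continuous_id⟩

/-- Composition of continuous functors. -/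
def Hom.comp {𝔊 ℌ 𝔎 : ProfGrpd.{u}} (A : Hom 𝔊 ℌ) (B : Hom ℌ 𝔎) : Hom 𝔊 𝔎 :=
  ⟨A.obj ⋙ B.obj, fun x y => (B.property _ _).comp (A.property x y)⟩

/-- The 2-category of finitely connected profinite groupoids. -/
instance bicategory : Bicategory.{u, u} ProfGrpd.{u} where
  Hom 𝔊 ℌ := Hom 𝔊 ℌ
  id 𝔊 := Hom.id 𝔊
  comp A B := Hom.comp A B
  homCategory 𝔊 ℌ := ObjectProperty.FullSubcategory.category (isContinuous 𝔊 ℌ)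
  whiskerLeft A _ _ a :=
    ObjectProperty.homMk (Functor.whiskerLeft A.obj (InducedCategory.Hom.hom a))
  whiskerRight a B :=
    ObjectProperty.homMk (Functor.whiskerRight (InducedCategory.Hom.hom a) B.obj)
  associator A B D := ObjectProperty.isoMk (X := (A.comp B).comp D) (Y := A.comp (B.comp D)) _
    (Functor.associator A.obj B.obj D.obj)
  leftUnitor {𝔊 ℌ} A := ObjectProperty.isoMk (X := (Hom.id 𝔊).comp A) (Y := A) _
    (Functor.leftUnitor A.obj)
  rightUnitor {𝔊 ℌ} A := ObjectProperty.isoMk (X := A.comp (Hom.id ℌ)) (Y := A) _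
    (Functor.rightUnitor A.obj)
  whiskerLeft_id A B := InducedCategory.hom_ext (Functor.whiskerLeft_id A.obj)
  whiskerLeft_comp A _ _ _ a b := InducedCategory.hom_ext
    (Functor.whiskerLeft_comp A.obj (InducedCategory.Hom.hom a) (InducedCategory.Hom.hom b))
  id_whiskerLeft a := by
    apply InducedCategory.hom_ext; apply NatTrans.ext; funext x
    exact ((Category.id_comp _).trans (Category.comp_id _)).symm
  comp_whiskerLeft A B _ _ a := by
    apply InducedCategory.hom_ext; apply NatTrans.ext; funext x
    exact ((Category.id_comp _).trans (Category.comp_id _)).symm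
  id_whiskerRight A B := InducedCategory.hom_ext (Functor.whiskerRight_id B.obj)
  comp_whiskerRight a b B := InducedCategory.hom_ext
    (Functor.whiskerRight_comp (InducedCategory.Hom.hom a) (InducedCategory.Hom.hom b) B.obj)
  whiskerRight_id a := by
    apply InducedCategory.hom_ext; apply NatTrans.ext; funext x
    exact ((Category.id_comp _).trans (Category.comp_id _)).symm
  whiskerRight_comp a B D := by
    apply InducedCategory.hom_ext; apply NatTrans.ext; funext x
    exact ((Category.id_comp _).trans (Category.comp_id _)).symm
  whisker_assoc A _ _ a B := by
    apply InducedCategory.hom_ext; apply NatTrans.ext; funext x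
    exact ((Category.id_comp _).trans (Category.comp_id _)).symm
  whisker_exchange a b := by
    apply InducedCategory.hom_ext; apply NatTrans.ext; funext x
    exact ((InducedCategory.Hom.hom b).naturality ((InducedCategory.Hom.hom a).app x)).symm
  pentagon A B D E := InducedCategory.hom_ext (Functor.pentagon A.obj B.obj D.obj E.obj)
  triangle A B := InducedCategory.hom_ext (Functor.triangle A.obj B.obj)

/-! ### Finite sets with a continuous action of a profinite groupoid -/

/-- Continuous actions: functors to finite sets that are continuous on hom-sets, where the sets of
maps between finite sets are discrete. -/
def isContinuousAction (𝔊 : ProfGrpd.{u}) : ObjectProperty (𝔊.obj ⥤ FintypeCat.{u}) := fun X =>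
  ∀ x y, IsLocallyConstant fun g : x ⟶ y => X.map g

/-- The category `𝔊-FSets`. -/
abbrev FSets (𝔊 : ProfGrpd.{u}) : Type (u + 1) := (isContinuousAction 𝔊).FullSubcategory

/-- The fibre functor of `𝔊-FSets` at an object `x` of `𝔊`: evaluation at `x`. -/
def fibre (𝔊 : ProfGrpd.{u}) (x : 𝔊.obj) : FSets 𝔊 ⥤ FintypeCat.{u} :=
  (isContinuousAction 𝔊).ι ⋙ (evaluation 𝔊.obj FintypeCat.{u}).obj x

/-- The functor `ℌ-FSets ⥤ 𝔊-FSets` of precomposition with a continuous functor. -/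
def restrict {𝔊 ℌ : ProfGrpd.{u}} (A : Hom 𝔊 ℌ) : FSets ℌ ⥤ FSets 𝔊 :=
  (isContinuousAction 𝔊).lift
    ((isContinuousAction ℌ).ι ⋙ (Functor.whiskeringLeft _ _ FintypeCat.{u}).obj A.obj)
    (fun X x y => (X.property _ _).comp_continuous (A.property x y))

/-- The natural transformation of restriction functors induced by a natural transformation. -/
def restrict₂ {𝔊 ℌ : ProfGrpd.{u}} {A B : Hom 𝔊 ℌ} (a : A ⟶ B) : restrict A ⟶ restrict B where
  app X := ObjectProperty.homMk (Functor.whiskerRight a.hom X.obj)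
  naturality X Y t := by
    apply InducedCategory.hom_ext; apply NatTrans.ext; funext x
    exact (t.hom.naturality (a.hom.app x)).symm

/-- `𝔊-FSets` with its fibre functors is a finitely connected Galois category. -/
def FSetsIsGalois (𝔊 : ProfGrpd.{u}) : Prop :=
  EssentiallySmall.{u} (FSets 𝔊) ∧ IsGalois (fibre 𝔊)

/-- Restriction along a continuous functor preserves finite limits and finite colimits. -/
def RestrictIsExact {𝔊 ℌ : ProfGrpd.{u}} (A : Hom 𝔊 ℌ) : Prop :=
  PreservesFiniteLimits (restrict A) ∧ PreservesFiniteColimits (restrict A)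

/-- The Galois category `𝔊-FSets`. -/
def toGCat (𝔊 : ProfGrpd.{u}) (h : FSetsIsGalois 𝔊) : GCat.{u} where
  C := FSets 𝔊
  essentiallySmall := h.1
  J := 𝔊.obj
  F := fibre 𝔊
  isGalois := h.2

/-- The morphism of Galois categories `ℌ-FSets ⟶ 𝔊-FSets` given by a continuous functor
`A : 𝔊 ⟶ ℌ`: composition with `A`, the map `A` on objects, and identities. -/
def toGCatHom {𝔊 ℌ : ProfGrpd.{u}} (A : Hom 𝔊 ℌ) (h𝔊 : FSetsIsGalois 𝔊) (hℌ : FSetsIsGalois ℌ)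
    (hA : RestrictIsExact A) : GCat.Hom (toGCat ℌ hℌ) (toGCat 𝔊 h𝔊) where
  f := fun x => A.obj.obj x
  φ := restrict A
  preservesFiniteLimits := hA.1
  preservesFiniteColimits := hA.2
  lam _ := Iso.refl _

/-- The contravariant 2-functor `𝔊 ↦ 𝔊-FSets`, given on continuous functors and on natural
transformations by composition. -/
def fSetsPseudofunctor (hobj : ∀ 𝔊 : ProfGrpd.{u}, FSetsIsGalois 𝔊)
    (hmap : ∀ {𝔊 ℌ : ProfGrpd.{u}} (A : 𝔊 ⟶ ℌ), RestrictIsExact A) :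
    Pseudofunctor ProfGrpd.{u}ᵒᵖ GCat.{u} where
  obj 𝔊 := toGCat 𝔊.unop (hobj 𝔊.unop)
  map {ℌ 𝔊} A := toGCatHom A.unop (hobj 𝔊.unop) (hobj ℌ.unop) (hmap A.unop)
  map₂ {ℌ 𝔊 A B} a := GCat.Hom₂.ofNatTrans
    (p := toGCatHom A.unop (hobj 𝔊.unop) (hobj ℌ.unop) (hmap A.unop))
    (q := toGCatHom B.unop (hobj 𝔊.unop) (hobj ℌ.unop) (hmap B.unop))
    (restrict₂ a.unop2)
  map₂_id A := by
    apply GCat.Hom₂.ext_ζ; apply NatTrans.ext; funext X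
    apply InducedCategory.hom_ext; apply NatTrans.ext; funext x
    exact X.obj.map_id _
  map₂_comp a b := by
    apply GCat.Hom₂.ext_ζ; apply NatTrans.ext; funext X
    apply InducedCategory.hom_ext; apply NatTrans.ext; funext x
    exact X.obj.map_comp _ _
  mapId 𝔊 := GCat.isoOfNatIso
    (p := toGCatHom (Hom.id 𝔊.unop) (hobj 𝔊.unop) (hobj 𝔊.unop) (hmap (Hom.id 𝔊.unop)))
    (q := GCat.Hom.id (toGCat 𝔊.unop (hobj 𝔊.unop)))
    (Iso.refl (𝟭 (FSets 𝔊.unop)))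
  mapComp {𝔎 ℌ 𝔊} A B := GCat.isoOfNatIso
    (p := toGCatHom (Hom.comp B.unop A.unop) (hobj 𝔊.unop) (hobj 𝔎.unop)
      (hmap (Hom.comp B.unop A.unop)))
    (q := GCat.Hom.comp (toGCatHom A.unop (hobj ℌ.unop) (hobj 𝔎.unop) (hmap A.unop))
      (toGCatHom B.unop (hobj 𝔊.unop) (hobj ℌ.unop) (hmap B.unop)))
    (Iso.refl (restrict A.unop ⋙ restrict B.unop))
  map₂_whisker_left A _ _ b := by
    apply GCat.Hom₂.ext_ζ; apply NatTrans.ext; funext X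
    apply InducedCategory.hom_ext; apply NatTrans.ext; funext x
    exact ((Category.id_comp _).trans (Category.comp_id _)).symm
  map₂_whisker_right a B := by
    apply GCat.Hom₂.ext_ζ; apply NatTrans.ext; funext X
    apply InducedCategory.hom_ext; apply NatTrans.ext; funext x
    exact ((Category.id_comp _).trans (Category.comp_id _)).symm
  map₂_associator A B D := by
    apply GCat.Hom₂.ext_ζ; apply NatTrans.ext; funext X
    apply InducedCategory.hom_ext; apply NatTrans.ext; funext x
    exact (X.obj.map_id _).trans (by simp : 𝟙 (X.obj.obj _) = 𝟙 _ ≫ 𝟙 _ ≫ 𝟙 _ ≫ 𝟙 _ ≫ 𝟙 _)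
  map₂_left_unitor A := by
    apply GCat.Hom₂.ext_ζ; apply NatTrans.ext; funext X
    apply InducedCategory.hom_ext; apply NatTrans.ext; funext x
    exact (X.obj.map_id _).trans (by simp : 𝟙 (X.obj.obj _) = 𝟙 _ ≫ 𝟙 _ ≫ 𝟙 _)
  map₂_right_unitor A := by
    apply GCat.Hom₂.ext_ζ; apply NatTrans.ext; funext X
    apply InducedCategory.hom_ext; apply NatTrans.ext; funext x
    exact (X.obj.map_id _).trans (by simp : 𝟙 (X.obj.obj _) = 𝟙 _ ≫ 𝟙 _ ≫ 𝟙 _)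

end ProfGrpd

end

noncomputable section

/-! ### Actions of a profinite groupoid on finite sets -/

/-! The proof is Tannakian reconstruction in both directions, with compactness passing from finitely
many objects to all of them.

From groupoids to categories: finite limits and colimits of actions are computed objectwise. The
image of a map of actions is a direct summand because the complement of a stable subset is stable
under invertible morphisms, and representatives of the finitely many isomorphism classes of objects
give a conservative family. Full faithfulness rests on the identification of `Hom(a, b)`, with its
topology, with the natural transformations of fibre functors at `a` and `b`. Cosets of open
subgroups separate morphisms (`FSets.separates`); the action of tuples induced by morphisms realises
a transformation on finitely many objects, and compactness realises it on all (`exists_hom`). A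
morphism of Galois categories then gives a functor by conjugating with its isomorphisms `lam`.

From categories to groupoids: the objects of the groupoid are the fibre functors, its morphisms
their natural transformations with the topology of pointwise convergence. Every point lies in a
connected subobject, found by minimising fibre sizes, and a morphism out of a connected object is
determined by its value at one point. With Tychonoff's theorem this yields transformations carrying
any point of a connected object to any other (`exists_natTrans`); all transformations are invertible
(`isIso_natTrans`), and finitely many fibre functors represent every isomorphism class
(`exists_finset_natTrans`). Stable subsets of fibres come from subobjects (`exists_subobject`), so
taking fibres is full by graphs, and essentially surjective because each action is a quotient of a
fibre action by a relation that is itself a subobject. -/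

/-- A function which is determined by finitely many locally constant functions is locally
constant. -/
theorem IsLocallyConstant.of_finite_family {X α ι : Type*} [TopologicalSpace X] [Finite ι]
    {β : ι → Type*} {f : X → α} (g : ∀ i, X → β i) (hg : ∀ i, IsLocallyConstant (g i))
    (h : ∀ x y, (∀ i, g i x = g i y) → f x = f y) : IsLocallyConstant f := by
  rw [IsLocallyConstant.iff_eventually_eq]
  intro x
  filter_upwards [Filter.eventually_all.2 fun i => (hg i).eventually_eq x] with y hy
  exact h y x hy

namespace ProfGrpd

variable {𝔊 ℌ : ProfGrpd.{u}}

/-- A morphism acts on a limit through its actions on the finitely many objects of the diagram, each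
of which is locally constant in the morphism. The same argument serves for colimits. -/
theorem isContinuousAction_isClosedUnderLimits (K : Type) [SmallCategory K] [FinCategory K] :
    (isContinuousAction 𝔊).IsClosedUnderLimitsOfShape K where
  limitsOfShape_le := by
    rintro X ⟨p⟩ x y
    refine IsLocallyConstant.of_finite_family (fun k g => (p.diag.obj k).map g)
      (fun k => p.prop_diag_obj k x y) fun g h hgh => ?_
    refine (isLimitOfPreserves ((evaluation _ _).obj y) p.isLimit).hom_ext fun k => ?_
    change X.map g ≫ (p.π.app k).app y = X.map h ≫ (p.π.app k).app y
    rw [NatTrans.naturality, NatTrans.naturality]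
    exact congrArg _ (hgh k)

theorem isContinuousAction_isClosedUnderColimits (K : Type) [SmallCategory K] [FinCategory K] :
    (isContinuousAction 𝔊).IsClosedUnderColimitsOfShape K where
  colimitsOfShape_le := by
    rintro X ⟨p⟩ x y
    refine IsLocallyConstant.of_finite_family (fun k g => (p.diag.obj k).map g)
      (fun k => p.prop_diag_obj k x y) fun g h hgh => ?_
    refine (isColimitOfPreserves ((evaluation _ _).obj x) p.isColimit).hom_ext fun k => ?_
    change (p.ι.app k).app x ≫ X.map g = (p.ι.app k).app x ≫ X.map h
    exact ((p.ι.app k).naturality g).symm.trans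
      ((congrArg (· ≫ _) (hgh k)).trans ((p.ι.app k).naturality h))

attribute [local instance] isContinuousAction_isClosedUnderLimits
  isContinuousAction_isClosedUnderColimits

instance FSets.hasFiniteLimits : HasFiniteLimits (FSets 𝔊) where
  out _ := inferInstance

instance FSets.hasFiniteColimits : HasFiniteColimits (FSets 𝔊) where
  out _ := inferInstance

instance FSets.preservesFiniteLimits_ι : PreservesFiniteLimits (isContinuousAction 𝔊).ι where
  preservesFiniteLimits _ := inferInstance

instance FSets.preservesFiniteColimits_ι : PreservesFiniteColimits (isContinuousAction 𝔊).ι where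
  preservesFiniteColimits _ := inferInstance

instance fibre_preservesFiniteLimits (x : 𝔊.obj) : PreservesFiniteLimits (fibre 𝔊 x) where
  preservesFiniteLimits _ := by unfold fibre; infer_instance

instance fibre_preservesFiniteColimits (x : 𝔊.obj) : PreservesFiniteColimits (fibre 𝔊 x) where
  preservesFiniteColimits _ := by unfold fibre; infer_instance

theorem restrictIsExact (A : Hom 𝔊 ℌ) : RestrictIsExact A := by
  refine ⟨⟨fun K _ _ => ?_⟩, ⟨fun K _ _ => ?_⟩⟩
  · have : PreservesLimitsOfShape K (restrict A ⋙ (isContinuousAction 𝔊).ι) :=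
      inferInstanceAs (PreservesLimitsOfShape K ((isContinuousAction ℌ).ι ⋙
        (Functor.whiskeringLeft _ _ FintypeCat.{u}).obj A.obj))
    exact preservesLimitsOfShape_of_reflects_of_preserves _ (isContinuousAction 𝔊).ι
  · have : PreservesColimitsOfShape K (restrict A ⋙ (isContinuousAction 𝔊).ι) :=
      inferInstanceAs (PreservesColimitsOfShape K ((isContinuousAction ℌ).ι ⋙
        (Functor.whiskeringLeft _ _ FintypeCat.{u}).obj A.obj))
    exact preservesColimitsOfShape_of_reflects_of_preserves _ (isContinuousAction 𝔊).ι

/-- Finite sets have a small skeleton, and actions embed fully faithfully into functors with values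
in it. -/
instance FSets.essentiallySmall : EssentiallySmall.{u} (FSets 𝔊) := by
  have : Small.{u} FintypeCat.Skeleton.{u} := inferInstanceAs (Small.{u} (ULift.{u} ℕ))
  have : EssentiallySmall.{u} (𝔊.obj ⥤ FintypeCat.Skeleton.{u}) :=
    essentiallySmall_of_small_of_locallySmall _
  exact essentiallySmall_of_fully_faithful ((isContinuousAction 𝔊).ι ⋙
    (Functor.whiskeringRight _ _ _).obj FintypeCat.Skeleton.equivalence.inverse)

theorem isIso_iff_bijective {X Y : FintypeCat.{u}} (f : X ⟶ Y) :
    IsIso f ↔ Function.Bijective f :=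
  ConcreteCategory.isIso_iff_bijective f

theorem FSets.isIso_iff {X Y : FSets 𝔊} (p : X ⟶ Y) :
    IsIso p ↔ ∀ x, Function.Bijective (p.hom.app x) := by
  have : IsIso p ↔ IsIso ((isContinuousAction 𝔊).ι.map p) :=
    (isIso_iff_of_reflects_iso p (isContinuousAction 𝔊).ι).symm
  rw [this, NatTrans.isIso_iff_isIso_app]
  exact forall_congr' fun x => isIso_iff_bijective _

/-- The representatives of the finitely many isomorphism classes of objects. -/
theorem exists_finset_representatives (𝔊 : ProfGrpd.{u}) :
    ∃ I : Finset 𝔊.obj, ∀ x, ∃ y ∈ I, Nonempty (y ≅ x) := by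
  classical
  obtain ⟨n, G, e, -⟩ := 𝔊.finitelyConnected
  refine ⟨Finset.univ.image fun i => e.functor.obj ⟨i, SingleObj.star _⟩, fun x => ?_⟩
  refine ⟨e.functor.obj (e.inverse.obj x), ?_, ⟨e.counitIso.app x⟩⟩
  exact Finset.mem_image.2 ⟨(e.inverse.obj x).1, Finset.mem_univ _, rfl⟩

/-! ### Subobjects and quotients of actions -/

/-- A subset of a `𝔊`-set stable under the action, as a `𝔊`-set. -/
def FSets.sub (X : FSets 𝔊) (S : ∀ x, Set (X.obj.obj x))
    (hS : ∀ {x y} (g : x ⟶ y) s, s ∈ S x → X.obj.map g s ∈ S y) : FSets 𝔊 where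
  obj :=
    { obj x := FintypeCat.of (S x)
      map {x y} g := FintypeCat.homMk fun s => ⟨X.obj.map g s.1, hS g _ s.2⟩
      map_id x := by ext s; exact ConcreteCategory.congr_hom (X.obj.map_id x) s.1
      map_comp g h := by
        ext s; exact ConcreteCategory.congr_hom (X.obj.map_comp g h) s.1 }
  property x y := by
    refine IsLocallyConstant.of_finite_family (ι := Unit) (fun _ g => X.obj.map g)
      (fun _ => X.property x y) fun g h hgh => ?_
    ext s
    exact ConcreteCategory.congr_hom (hgh ()) s.1

/-- The inclusion of a stable subset. -/
def FSets.subι (X : FSets 𝔊) (S : ∀ x, Set (X.obj.obj x))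
    (hS : ∀ {x y} (g : x ⟶ y) s, s ∈ S x → X.obj.map g s ∈ S y) : X.sub S hS ⟶ X :=
  ObjectProperty.homMk { app x := FintypeCat.homMk Subtype.val }

/-- Corestriction of a morphism to a stable subset. -/
def FSets.subLift {X Y : FSets 𝔊} (S : ∀ x, Set (X.obj.obj x))
    (hS : ∀ {x y} (g : x ⟶ y) s, s ∈ S x → X.obj.map g s ∈ S y) (p : Y ⟶ X)
    (hp : ∀ x s, p.hom.app x s ∈ S x) : Y ⟶ X.sub S hS :=
  ObjectProperty.homMk
    { app x := FintypeCat.homMk fun s => ⟨p.hom.app x s, hp x s⟩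
      naturality x y g := by
        ext s; exact Subtype.ext (ConcreteCategory.congr_hom (p.hom.naturality g) s) }

theorem FSets.hom_ext {X Y : FSets 𝔊} {p q : X ⟶ Y}
    (h : ∀ x s, p.hom.app x s = q.hom.app x s) : p = q := by
  apply InducedCategory.hom_ext; apply NatTrans.ext; funext x; ext s; exact h x s

theorem FSets.naturality {X Y : FSets 𝔊} (p : X ⟶ Y) {x y : 𝔊.obj} (g : x ⟶ y) (s : X.obj.obj x) :
    p.hom.app y (X.obj.map g s) = Y.obj.map g (p.hom.app x s) :=
  ConcreteCategory.congr_hom (p.hom.naturality g) s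

theorem FSets.comp_app {X Y Z : FSets 𝔊} (p : X ⟶ Y) (q : Y ⟶ Z) (x : 𝔊.obj) (s : X.obj.obj x) :
    (p ≫ q).hom.app x s = q.hom.app x (p.hom.app x s) := rfl

/-- Descent of a morphism along a surjection. -/
theorem FSets.exists_desc {X Y Z : FSets 𝔊} (p : X ⟶ Y)
    (hp : ∀ x, Function.Surjective (p.hom.app x)) (t : X ⟶ Z)
    (ht : ∀ x s s', p.hom.app x s = p.hom.app x s' → t.hom.app x s = t.hom.app x s') :
    ∃ d : Y ⟶ Z, p ≫ d = t := by
  have key : ∀ x s, t.hom.app x ((hp x (p.hom.app x s)).choose) = t.hom.app x s := fun x s =>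
    ht x _ _ (hp x (p.hom.app x s)).choose_spec
  refine ⟨ObjectProperty.homMk
    { app x := FintypeCat.homMk fun s => t.hom.app x (hp x s).choose
      naturality x y g := ?_ }, FSets.hom_ext key⟩
  ext s
  obtain ⟨s, rfl⟩ := hp x s
  change t.hom.app y (hp y (Y.obj.map g (p.hom.app x s))).choose =
    Z.obj.map g (t.hom.app x (hp x (p.hom.app x s)).choose)
  rw [← FSets.naturality p, key, key, FSets.naturality]

/-- Evaluation preserves pullbacks, so any two points with equal image come from a point of the
kernel pair; a map that coequalises the projections is therefore constant on the fibres of `p` and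
descends. -/
theorem FSets.isStrictEpi_of_surjective {X Y : FSets 𝔊} (p : X ⟶ Y)
    (hp : ∀ x, Function.Surjective (p.hom.app x)) : FinConnGalois.IsStrictEpi p := by
  have hepi : Epi p := ⟨fun a b hab => FSets.hom_ext fun x s => by
    obtain ⟨s, rfl⟩ := hp x s
    rw [← FSets.comp_app, ← FSets.comp_app, hab]⟩
  refine ⟨hepi, pullback p p, pullback.fst p p, pullback.snd p p, .of_hasPullback p p, ⟨?_⟩⟩
  have key (s : Cofork (pullback.fst p p) (pullback.snd p p)) : ∃ d, p ≫ d = s.π := by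
    refine FSets.exists_desc p hp s.π fun x a b hab => ?_
    have hpb := (IsPullback.of_hasPullback p p).map (fibre 𝔊 x ⋙ FintypeCat.incl)
    obtain ⟨c, hc₁, hc₂⟩ := Types.exists_of_isPullback hpb a b hab
    have h := ConcreteCategory.congr_hom (congrArg (fibre 𝔊 x).map s.condition) c
    refine (congrArg (s.π.hom.app x) hc₁).symm.trans (Eq.trans h (congrArg (s.π.hom.app x) hc₂))
  exact Cofork.IsColimit.mk _ (fun s => (key s).choose) (fun s => (key s).choose_spec)
    fun s m hm => (cancel_epi p).1 (hm.trans (key s).choose_spec.symm)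

/-- The image of `p` is a stable subset. A morphism taking a point of the complement into the image
would have an inverse taking it back, so the complement is stable too. -/
theorem FSets.factorisation {Y X : FSets 𝔊} (p : Y ⟶ X) :
    ∃ (X' : FSets 𝔊) (p' : Y ⟶ X') (p'' : X' ⟶ X),
      p' ≫ p'' = p ∧ FinConnGalois.IsStrictEpi p' ∧ Mono p'' ∧
        ∃ (X'' : FSets 𝔊) (q : X'' ⟶ X), Nonempty (IsColimit (BinaryCofan.mk p'' q)) := by
  classical
  let S : ∀ x, Set (X.obj.obj x) := fun x => Set.range (p.hom.app x)
  have hS : ∀ {x y} (g : x ⟶ y) s, s ∈ S x → X.obj.map g s ∈ S y := by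
    rintro x y g _ ⟨s, rfl⟩
    exact ⟨Y.obj.map g s, FSets.naturality p g s⟩
  have hT : ∀ {x y} (g : x ⟶ y) s, s ∈ (S x)ᶜ → X.obj.map g s ∈ (S y)ᶜ := by
    intro x y g s hs hs'
    refine hs ?_
    have := hS (Groupoid.inv g) _ hs'
    rwa [← ConcreteCategory.comp_apply, ← X.obj.map_comp, Groupoid.comp_inv, X.obj.map_id,
      FintypeCat.id_apply] at this
  refine ⟨X.sub S hS, FSets.subLift S hS p fun x s => ⟨s, rfl⟩, X.subι S hS, rfl,
    FSets.isStrictEpi_of_surjective _ ?_, ?_, X.sub (fun x => (S x)ᶜ) hT, X.subι _ hT, ⟨?_⟩⟩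
  · rintro x ⟨_, s, rfl⟩
    exact ⟨s, rfl⟩
  · exact ⟨fun a b hab => FSets.hom_ext fun x s => Subtype.ext
      (ConcreteCategory.congr_hom (congrArg (fun f => f.hom.app x) hab) s)⟩
  · refine BinaryCofan.isColimitMk (fun s => ObjectProperty.homMk
      { app x := FintypeCat.homMk fun a =>
          if h : a ∈ S x then s.inl.hom.app x ⟨a, h⟩ else s.inr.hom.app x ⟨a, h⟩
        naturality x y g := ?_ }) (fun s => FSets.hom_ext fun x a => ?_)
      (fun s => FSets.hom_ext fun x a => ?_) fun s m h₁ h₂ => FSets.hom_ext fun x a => ?_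
    · ext a
      by_cases h : a ∈ S x
      · refine (dif_pos (hS g _ h)).trans (Eq.trans ?_ (congrArg (s.pt.obj.map g) (dif_pos h).symm))
        exact FSets.naturality s.inl g ⟨a, h⟩
      · refine (dif_neg (hT g _ h)).trans (Eq.trans ?_ (congrArg (s.pt.obj.map g) (dif_neg h).symm))
        exact FSets.naturality s.inr g ⟨a, h⟩
    · exact dif_pos a.2
    · exact dif_neg a.2
    · by_cases h : a ∈ S x
      · refine Eq.trans ?_ (dif_pos h).symm
        rw [← h₁]; rfl
      · refine Eq.trans ?_ (dif_neg h).symm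
        rw [← h₂]; rfl

theorem fSetsIsGalois (𝔊 : ProfGrpd.{u}) : FSetsIsGalois 𝔊 := by
  refine ⟨inferInstance, inferInstance, inferInstance, FSets.factorisation,
    fun _ => inferInstance, fun _ => inferInstance, ?_⟩
  obtain ⟨I, hI⟩ := exists_finset_representatives 𝔊
  refine ⟨I, fun {Y X} p => ⟨fun h i _ => inferInstance, fun h => ?_⟩⟩
  rw [FSets.isIso_iff]
  intro x
  obtain ⟨y, hy, ⟨e⟩⟩ := hI x
  have : IsIso (p.hom.app y) := h y hy
  have : p.hom.app x = Y.obj.map e.inv ≫ p.hom.app y ≫ X.obj.map e.hom := by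
    rw [← p.hom.naturality, ← Category.assoc, ← Y.obj.map_comp, e.inv_hom_id, Y.obj.map_id,
      Category.id_comp]
  rw [← isIso_iff_bijective, this]
  infer_instance

end ProfGrpd

namespace ProfGrpd

variable {𝔊 ℌ : ProfGrpd.{u}}

attribute [local instance] ProfGrpd.compact ProfGrpd.hausdorff ProfGrpd.totallyDisconnected

theorem isLocallyConstant_hom {T : Type*} [TopologicalSpace T] {X Y : FintypeCat.{u}}
    {f : T → (X ⟶ Y)} (hf : ∀ s, IsLocallyConstant fun t => f t s) : IsLocallyConstant f :=
  .of_finite_family (fun s t => f t s) hf fun _ _ h => FintypeCat.hom_ext _ _ h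

/-! ### Objects of `𝔊-FSets` separate morphisms -/

/-- The automorphisms of an object contain arbitrarily small open subgroups. -/
theorem exists_open_subgroup_not_mem {a : 𝔊.obj} {k : a ⟶ a} (hk : k ≠ 𝟙 a) :
    ∃ U : Set (a ⟶ a), IsOpen U ∧ 𝟙 a ∈ U ∧ (∀ g ∈ U, ∀ h ∈ U, g ≫ h ∈ U) ∧
      (∀ g ∈ U, Groupoid.inv g ∈ U) ∧ k ∉ U := by
  let _ : TopologicalSpace (End a) := 𝔊.top a a
  have : CompactSpace (End a) := 𝔊.compact a a
  have : T2Space (End a) := 𝔊.hausdorff a a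
  have : TotallyDisconnectedSpace (End a) := 𝔊.totallyDisconnected a a
  have : IsTopologicalGroup (End a) :=
    -- Multiplication in `End a` is composition in the opposite order, hence the swap.
    { continuous_mul := (𝔊.continuous_comp a a a).comp continuous_swap
      continuous_inv := 𝔊.continuous_inv a a }
  obtain ⟨H, hH⟩ := ProfiniteGrp.exist_openNormalSubgroup_sub_open_nhds_of_one
    (G := End a) (U := {k}ᶜ) isOpen_compl_singleton (fun h => hk h.symm)
  exact ⟨(H : Set (End a)), H.isOpen', H.one_mem, fun g hg h hh => H.mul_mem hh hg,
    fun g hg => H.inv_mem hg, fun h => hH h rfl⟩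

section Cosets

variable {a : 𝔊.obj} {U : Set (a ⟶ a)} (hU : IsOpen U) (h₁ : 𝟙 a ∈ U)
  (h₂ : ∀ g ∈ U, ∀ h ∈ U, g ≫ h ∈ U) (h₃ : ∀ g ∈ U, Groupoid.inv g ∈ U)

/-- Morphisms out of `a` modulo an open subgroup of the automorphism group of `a`. -/
@[reducible]
def cosetSetoid (h₁ : 𝟙 a ∈ U) (h₂ : ∀ g ∈ U, ∀ h ∈ U, g ≫ h ∈ U)
    (h₃ : ∀ g ∈ U, Groupoid.inv g ∈ U) (b : 𝔊.obj) : Setoid (a ⟶ b) where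
  r g h := g ≫ Groupoid.inv h ∈ U
  iseqv :=
    { refl g := by rwa [Groupoid.comp_inv]
      symm {g h} hg := by
        have := h₃ _ hg
        simpa using this
      trans {g h k} hg hh := by
        have := h₂ _ hg _ hh
        simpa using this }

include hU in
theorem isLocallyConstant_cosetMk (b : 𝔊.obj) :
    IsLocallyConstant (Quotient.mk (cosetSetoid h₁ h₂ h₃ b)) := by
  rw [IsLocallyConstant.iff_exists_open]
  intro g
  refine ⟨{h | h ≫ Groupoid.inv g ∈ U}, hU.preimage ((𝔊.continuous_comp a b a).comp
    (continuous_id.prodMk continuous_const)), ?_, fun h hh => Quotient.sound hh⟩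
  change g ≫ Groupoid.inv g ∈ U
  rwa [Groupoid.comp_inv]

include hU in
-- The quotient map is locally constant on a compact space, so it has finite range.
theorem finite_coset (b : 𝔊.obj) : Finite (Quotient (cosetSetoid h₁ h₂ h₃ b)) := by
  have := (isLocallyConstant_cosetMk hU h₁ h₂ h₃ b).range_finite
  rw [Set.range_eq_univ.2 Quotient.mk_surjective] at this
  exact Set.finite_univ_iff.1 this

/-- The `𝔊`-set of morphisms out of `a` modulo an open subgroup of the automorphism group of `a`. -/
def FSets.coset : FSets 𝔊 where
  obj :=
    { obj b :=
        haveI := finite_coset hU h₁ h₂ h₃ b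
        FintypeCat.of (Quotient (cosetSetoid h₁ h₂ h₃ b))
      map {b c} k := FintypeCat.homMk (Quotient.map' (· ≫ k) fun g h (hgh : _ ∈ U) => by
        change _ ∈ U; simpa using hgh)
      map_id b := by
        ext s; obtain ⟨g, rfl⟩ := Quotient.mk_surjective s
        exact congrArg (Quotient.mk _) (Category.comp_id g)
      map_comp k l := by
        ext s; obtain ⟨g, rfl⟩ := Quotient.mk_surjective s
        exact congrArg (Quotient.mk _) (Category.assoc g k l).symm }
  property b c := by
    refine isLocallyConstant_hom fun s => ?_
    obtain ⟨g, rfl⟩ := Quotient.mk_surjective s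
    exact (isLocallyConstant_cosetMk hU h₁ h₂ h₃ c).comp_continuous
      ((𝔊.continuous_comp a b c).comp (continuous_const.prodMk continuous_id))

end Cosets

/-- If `g ≠ h`, some open subgroup `U` of the automorphisms of `a` omits `g ≫ h⁻¹`. Then `g` and `h`
send the class of `𝟙 a` to different cosets. -/
theorem FSets.separates {a b : 𝔊.obj} {g h : a ⟶ b} (H : ∀ X : FSets 𝔊, X.obj.map g = X.obj.map h) :
    g = h := by
  by_contra hne
  have hk : g ≫ Groupoid.inv h ≠ 𝟙 a := fun hk => hne (by
    simpa using congrArg (· ≫ h) hk)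
  obtain ⟨U, hU, h₁, h₂, h₃, hkU⟩ := exists_open_subgroup_not_mem hk
  have := ConcreteCategory.congr_hom (H (FSets.coset hU h₁ h₂ h₃))
    (Quotient.mk (cosetSetoid h₁ h₂ h₃ a) (𝟙 a))
  have hr := Quotient.exact (s := cosetSetoid h₁ h₂ h₃ b) this
  refine hkU ?_
  have hr' : (𝟙 a ≫ g) ≫ Groupoid.inv (𝟙 a ≫ h) ∈ U := hr
  simpa using hr'

/-! ### Natural transformations between fibre functors -/

/-- The `𝔊`-set of tuples of maps `X i a ⟶ X i b` that are given by a morphism `a ⟶ b`. -/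
def FSets.tuple (a : 𝔊.obj) {n : ℕ} (X : Fin n → FSets 𝔊) : FSets 𝔊 where
  obj :=
    { obj b := FintypeCat.of {φ : ∀ i, (X i).obj.obj a ⟶ (X i).obj.obj b //
        ∃ g : a ⟶ b, ∀ i, φ i = (X i).obj.map g}
      map {b c} k := FintypeCat.homMk fun φ => ⟨fun i => φ.1 i ≫ (X i).obj.map k, by
        obtain ⟨g, hg⟩ := φ.2
        exact ⟨g ≫ k, fun i => by
          rw [(X i).obj.map_comp, ← hg i]⟩⟩
      map_id b := by
        ext φ : 1
        exact Subtype.ext (funext fun i => by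
          change φ.1 i ≫ _ = φ.1 i
          rw [(X i).obj.map_id, Category.comp_id])
      map_comp k l := by
        ext φ : 1
        exact Subtype.ext (funext fun i => by
          change φ.1 i ≫ _ = (φ.1 i ≫ _) ≫ _
          rw [(X i).obj.map_comp, Category.assoc]) }
  property b c := by
    refine .of_finite_family (fun i k => (X i).obj.map k) (fun i => (X i).property b c)
      fun k l hkl => ?_
    ext φ : 1
    exact Subtype.ext (funext fun i => congrArg (φ.1 i ≫ ·) (hkl i))

/-- Evaluation of a tuple of maps at an element. -/
def FSets.tupleEval (a : 𝔊.obj) {n : ℕ} (X : Fin n → FSets 𝔊) (i : Fin n) (s : (X i).obj.obj a) :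
    FSets.tuple a X ⟶ X i :=
  ObjectProperty.homMk { app b := FintypeCat.homMk fun φ => φ.1 i s }

theorem fibre_naturality {a b : 𝔊.obj} (τ : fibre 𝔊 a ⟶ fibre 𝔊 b) {X Y : FSets 𝔊} (p : X ⟶ Y)
    (s : X.obj.obj a) : τ.app Y (p.hom.app a s) = p.hom.app b (τ.app X s) :=
  ConcreteCategory.congr_hom (τ.naturality p) s

/-- The tuple of identities is a point of `FSets.tuple a X` over `a`, and `τ` sends it to a tuple
which by construction is induced by some `g`. Naturality with respect to the evaluation maps shows
that `τ` acts on each `X i` as `g`. -/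
theorem exists_hom_of_fin {a b : 𝔊.obj} (τ : fibre 𝔊 a ⟶ fibre 𝔊 b) {n : ℕ}
    (X : Fin n → FSets 𝔊) : ∃ g : a ⟶ b, ∀ i, (X i).obj.map g = τ.app (X i) := by
  let e : (FSets.tuple a X).obj.obj a := ⟨fun i => 𝟙 _, 𝟙 a, fun i => ((X i).obj.map_id a).symm⟩
  obtain ⟨g, hg⟩ := (show {φ : ∀ i, (X i).obj.obj a ⟶ (X i).obj.obj b //
        ∃ g : a ⟶ b, ∀ i, φ i = (X i).obj.map g} from τ.app (FSets.tuple a X) e).2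
  refine ⟨g, fun i => ?_⟩
  ext s
  rw [← hg]
  exact (fibre_naturality τ (FSets.tupleEval a X i s) e).symm

/-- Every natural transformation of fibre functors is given by a morphism of the groupoid. -/
theorem exists_hom {a b : 𝔊.obj} (τ : fibre 𝔊 a ⟶ fibre 𝔊 b) :
    ∃ g : a ⟶ b, ∀ X : FSets 𝔊, X.obj.map g = τ.app X := by
  -- For each action the morphisms inducing `τ` form a closed set. Finitely many of these sets meet,
  -- so by compactness of `Hom(a, b)` all of them do.
  have := IsCompact.inter_iInter_nonempty (isCompact_univ (X := a ⟶ b))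
    (fun X : FSets 𝔊 => {g : a ⟶ b | X.obj.map g = τ.app X})
    (fun X => (X.property a b).isClosed_fiber (τ.app X)) fun s => by
      obtain ⟨g, hg⟩ := exists_hom_of_fin τ fun i => (s.equivFin.symm i).1
      refine ⟨g, trivial, Set.mem_iInter₂.2 fun X hX => ?_⟩
      have := hg (s.equivFin ⟨X, hX⟩)
      rwa [Equiv.symm_apply_apply] at this
  obtain ⟨g, -, hg⟩ := this
  exact ⟨g, fun X => Set.mem_iInter.1 hg X⟩

/-- The natural transformation of fibre functors given by a morphism of the groupoid. -/
def fibreMap {a b : 𝔊.obj} (g : a ⟶ b) : fibre 𝔊 a ⟶ fibre 𝔊 b :=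
  Functor.whiskerLeft (isContinuousAction 𝔊).ι ((evaluation 𝔊.obj FintypeCat.{u}).map g)

/-- The morphism of the groupoid inducing a natural transformation of fibre functors. -/
def homOfNat {a b : 𝔊.obj} (τ : fibre 𝔊 a ⟶ fibre 𝔊 b) : a ⟶ b := (exists_hom τ).choose

theorem map_homOfNat {a b : 𝔊.obj} (τ : fibre 𝔊 a ⟶ fibre 𝔊 b) (X : FSets 𝔊) :
    X.obj.map (homOfNat τ) = τ.app X := (exists_hom τ).choose_spec X

theorem fibreMap_homOfNat {a b : 𝔊.obj} (τ : fibre 𝔊 a ⟶ fibre 𝔊 b) : fibreMap (homOfNat τ) = τ :=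
  NatTrans.ext (funext fun X => map_homOfNat τ X)

theorem fibreMap_injective {a b : 𝔊.obj} {g h : a ⟶ b} (H : fibreMap g = fibreMap h) : g = h :=
  FSets.separates fun X => congrArg (fun t => t.app X) H

theorem fibreMap_id (a : 𝔊.obj) : fibreMap (𝟙 a) = 𝟙 (fibre 𝔊 a) :=
  NatTrans.ext (funext fun X => X.obj.map_id a)

theorem fibreMap_comp {a b c : 𝔊.obj} (g : a ⟶ b) (h : b ⟶ c) :
    fibreMap (g ≫ h) = fibreMap g ≫ fibreMap h :=
  NatTrans.ext (funext fun X => X.obj.map_comp g h)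

/-- The topology of the groupoid is the weakest for which all actions are continuous. -/
theorem continuous_of_isLocallyConstant {T : Type*} [TopologicalSpace T] {a b : 𝔊.obj}
    {f : T → (a ⟶ b)} (hf : ∀ X : FSets 𝔊, IsLocallyConstant fun t => X.obj.map (f t)) :
    Continuous f := by
  let _ (X : FSets 𝔊) : TopologicalSpace (X.obj.obj a ⟶ X.obj.obj b) := ⊥
  have (X : FSets 𝔊) : DiscreteTopology (X.obj.obj a ⟶ X.obj.obj b) := ⟨rfl⟩
  let ι : (a ⟶ b) → ∀ X : FSets 𝔊, (X.obj.obj a ⟶ X.obj.obj b) := fun g X => X.obj.map g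
  -- A continuous injection from a compact space to a Hausdorff space is a closed embedding.
  have hι : Topology.IsClosedEmbedding ι := Continuous.isClosedEmbedding
    (continuous_pi fun X => (X.property a b).continuous)
    fun g h hgh => FSets.separates fun X => congrFun hgh X
  exact hι.isInducing.continuous_iff.2 (continuous_pi fun X => (hf X).continuous)

/-! ### Full faithfulness -/

theorem restrict₂_injective {A B : Hom 𝔊 ℌ} {s t : A ⟶ B} (h : restrict₂ s = restrict₂ t) :
    s = t := by
  apply InducedCategory.hom_ext; apply NatTrans.ext; funext x
  exact FSets.separates fun X => congrArg (fun r => (r.app X).hom.app x) h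

theorem restrict₂_surjective {A B : Hom 𝔊 ℌ} (ζ : restrict A ⟶ restrict B) :
    ∃ s : A ⟶ B, restrict₂ s = ζ := by
  let τ (x : 𝔊.obj) : fibre ℌ (A.obj.obj x) ⟶ fibre ℌ (B.obj.obj x) :=
    Functor.whiskerRight ζ (fibre 𝔊 x)
  refine ⟨ObjectProperty.homMk { app x := homOfNat (τ x), naturality x y g := ?_ }, ?_⟩
  · refine FSets.separates fun X => ?_
    rw [Functor.map_comp, Functor.map_comp, map_homOfNat, map_homOfNat]
    exact (ζ.app X).hom.naturality g
  · ext X : 2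
    apply InducedCategory.hom_ext; apply NatTrans.ext; funext x
    exact map_homOfNat (τ x) X

/-- Conjugating the action of `g` on fibres by `lam` gives a transformation between fibre functors
of `ℌ`, hence a morphism of `ℌ`; this is `A.map g`. By construction the components of `lam` commute
with the actions, so they assemble to the isomorphism. -/
theorem exists_iso_restrict (f : 𝔊.obj → ℌ.obj) (φ : FSets ℌ ⥤ FSets 𝔊)
    (lam : ∀ x, fibre ℌ (f x) ≅ φ ⋙ fibre 𝔊 x) : ∃ A : Hom 𝔊 ℌ, Nonempty (restrict A ≅ φ) := by
  let τ {x y : 𝔊.obj} (g : x ⟶ y) : fibre ℌ (f x) ⟶ fibre ℌ (f y) :=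
    (lam x).hom ≫ Functor.whiskerLeft φ (fibreMap g) ≫ (lam y).inv
  let A : 𝔊.obj ⥤ ℌ.obj :=
    { obj := f
      map g := homOfNat (τ g)
      map_id x := fibreMap_injective (by simp [τ, fibreMap_homOfNat, fibreMap_id])
      map_comp g h := fibreMap_injective (by simp [τ, fibreMap_homOfNat, fibreMap_comp]) }
  refine ⟨⟨A, fun x y => continuous_of_isLocallyConstant fun X => ?_⟩, ⟨?_⟩⟩
  · have := ((φ.obj X).property x y).comp
      fun m => ((lam x).hom.app X ≫ m ≫ (lam y).inv.app X : X.obj.obj (f x) ⟶ X.obj.obj (f y))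
    refine Eq.mp (congrArg _ (funext fun g => ?_)) this
    exact (map_homOfNat (τ g) X).symm
  · refine NatIso.ofComponents (fun X => ObjectProperty.isoMk _
      (NatIso.ofComponents (fun x => (lam x).app X) fun {x y} g => ?_)) fun {X Y} p => ?_
    · have h : fibreMap (A.map g) ≫ (lam y).hom =
          (lam x).hom ≫ Functor.whiskerLeft φ (fibreMap g) := by
        simp [A, τ, fibreMap_homOfNat]
      exact congrArg (fun t => t.app X) h
    · apply InducedCategory.hom_ext; apply NatTrans.ext; funext x
      exact (lam x).hom.naturality p

theorem fSetsPseudofunctor_mapFunctor_isEquivalence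
    (hobj : ∀ 𝔊 : ProfGrpd.{u}, FSetsIsGalois 𝔊)
    (hmap : ∀ {𝔊 ℌ : ProfGrpd.{u}} (A : 𝔊 ⟶ ℌ), RestrictIsExact A) (a b : ProfGrpd.{u}ᵒᵖ) :
    ((fSetsPseudofunctor hobj hmap).mapFunctor a b).IsEquivalence where
  faithful := ⟨fun {A B s t} h => by
    have := restrict₂_injective (congrArg GCat.Hom₂.ζ h)
    exact congrArg Bicategory.Opposite.Hom2.op2' this⟩
  full := ⟨fun {A B} z => by
    obtain ⟨s, hs⟩ := restrict₂_surjective (GCat.Hom₂.ζ z)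
    exact ⟨⟨s⟩, GCat.Hom₂.ext_ζ hs⟩⟩
  essSurj := ⟨fun p => by
    obtain ⟨A, ⟨e⟩⟩ := exists_iso_restrict (GCat.Hom.f p) (GCat.Hom.φ p) (GCat.Hom.lam p)
    exact ⟨Quiver.Hom.op A, ⟨GCat.isoOfNatIso e⟩⟩⟩

end ProfGrpd

namespace FinConnGalois

/-! ### Points of limits and colimits under an exact functor to finite sets -/

section Exact

variable {C : Type v} [Category.{w} C] (G : C ⥤ FintypeCat.{u})

theorem map_comp_apply {X Y Z : C} (f : X ⟶ Y) (g : Y ⟶ Z) (x : G.obj X) :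
    G.map (f ≫ g) x = G.map g (G.map f x) :=
  ConcreteCategory.congr_hom (G.map_comp f g) x

theorem surjective_of_epi [PreservesFiniteColimits G] {X Y : C} (f : X ⟶ Y) [Epi f] :
    Function.Surjective (G.map f) :=
  (epi_iff_surjective ((G ⋙ FintypeCat.incl).map f)).1 inferInstance

theorem injective_of_mono [PreservesFiniteLimits G] {X Y : C} (f : X ⟶ Y) [Mono f] :
    Function.Injective (G.map f) :=
  (mono_iff_injective ((G ⋙ FintypeCat.incl).map f)).1 inferInstance

theorem bijective_of_isIso {X Y : C} (f : X ⟶ Y) [IsIso f] : Function.Bijective (G.map f) :=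
  (ProfGrpd.isIso_iff_bijective _).1 inferInstance

theorem exists_mem_pi [HasFiniteLimits C] [PreservesFiniteLimits G] {K : Type*} [Finite K]
    (Y : K → C) (y : ∀ k, G.obj (Y k)) : ∃ z : G.obj (∏ᶜ Y), ∀ k, G.map (Pi.π Y k) z = y k := by
  let hl := isLimitFanMkObjOfIsLimit (G ⋙ FintypeCat.incl) Y _ (productIsProduct Y)
  let s : Fan fun k => (G ⋙ FintypeCat.incl).obj (Y k) :=
    Fan.mk PUnit.{u + 1} fun k => ↾fun _ => y k
  exact ⟨hl.lift s PUnit.unit, fun k => ConcreteCategory.congr_hom (hl.fac s ⟨k⟩) PUnit.unit⟩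

theorem pi_ext [HasFiniteLimits C] [PreservesFiniteLimits G] {K : Type*} [Finite K]
    (Y : K → C) {z z' : G.obj (∏ᶜ Y)} (h : ∀ k, G.map (Pi.π Y k) z = G.map (Pi.π Y k) z') :
    z = z' := by
  let hl := isLimitFanMkObjOfIsLimit (G ⋙ FintypeCat.incl) Y _ (productIsProduct Y)
  have : (↾fun _ : PUnit.{u + 1} => z) = (↾fun _ : PUnit.{u + 1} => z') :=
    hl.hom_ext fun ⟨k⟩ => by ext; exact h k
  exact ConcreteCategory.congr_hom this PUnit.unit

theorem exists_mem_prod [HasFiniteLimits C] [PreservesFiniteLimits G] {X Y : C} (x : G.obj X)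
    (y : G.obj Y) : ∃ z : G.obj (X ⨯ Y), G.map prod.fst z = x ∧ G.map prod.snd z = y := by
  let hl := mapIsLimitOfPreservesOfIsLimit (G ⋙ FintypeCat.incl) _ _ (prodIsProd X Y)
  let s : BinaryFan ((G ⋙ FintypeCat.incl).obj X) ((G ⋙ FintypeCat.incl).obj Y) :=
    BinaryFan.mk (P := PUnit.{u + 1}) (↾fun _ => x) (↾fun _ => y)
  exact ⟨hl.lift s PUnit.unit, ConcreteCategory.congr_hom (hl.fac s ⟨.left⟩) PUnit.unit,
    ConcreteCategory.congr_hom (hl.fac s ⟨.right⟩) PUnit.unit⟩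

theorem prod_ext [HasFiniteLimits C] [PreservesFiniteLimits G] {X Y : C} {z z' : G.obj (X ⨯ Y)}
    (h₁ : G.map prod.fst z = G.map prod.fst z') (h₂ : G.map prod.snd z = G.map prod.snd z') :
    z = z' := by
  let hl := mapIsLimitOfPreservesOfIsLimit (G ⋙ FintypeCat.incl) _ _ (prodIsProd X Y)
  have : (↾fun _ : PUnit.{u + 1} => z) = (↾fun _ : PUnit.{u + 1} => z') :=
    BinaryFan.IsLimit.hom_ext hl (by ext; exact h₁) (by ext; exact h₂)
  exact ConcreteCategory.congr_hom this PUnit.unit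

theorem exists_mem_equalizer [HasFiniteLimits C] [PreservesFiniteLimits G] {X Y : C} {f g : X ⟶ Y}
    {x : G.obj X} (h : G.map f x = G.map g x) :
    ∃ z : G.obj (equalizer f g), G.map (equalizer.ι f g) z = x := by
  let hl := isLimitForkMapOfIsLimit (G ⋙ FintypeCat.incl) _ (equalizerIsEqualizer f g)
  exact ((Types.type_equalizer_iff_unique _ _).1 ⟨hl⟩ x h).exists

theorem exists_of_mem_sigma [HasFiniteColimits C] [PreservesFiniteColimits G] {K : Type*} [Finite K]
    (Y : K → C) (z : G.obj (∐ Y)) : ∃ k y, G.map (Sigma.ι Y k) y = z := by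
  obtain ⟨⟨k⟩, y, hy⟩ := Types.jointly_surjective _
    (isColimitOfPreserves (G ⋙ FintypeCat.incl) (coproductIsCoproduct Y)) z
  exact ⟨k, y, hy⟩

end Exact

/-! ### The Galois axioms on fibres and connected objects -/

variable {C : Type v} [Category.{w} C] {J : Type u₁} {F : J → C ⥤ FintypeCat.{u}}

/-- The axioms of a finitely connected Galois category, formulated on fibres. -/
structure IsFibrewiseGalois (F : J → C ⥤ FintypeCat.{u}) : Prop where
  hasFiniteLimits : HasFiniteLimits C
  hasFiniteColimits : HasFiniteColimits C
  factorisation : ∀ {Y X : C} (p : Y ⟶ X),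
    ∃ (X' X'' : C) (p' : Y ⟶ X') (p'' : X' ⟶ X) (q : X'' ⟶ X),
    p' ≫ p'' = p ∧ ∀ j, Function.Surjective ((F j).map p') ∧ Function.Injective ((F j).map p'') ∧
      Function.Injective ((F j).map q) ∧
      IsCompl (Set.range ((F j).map p'')) (Set.range ((F j).map q))
  rightExact : ∀ j, PreservesFiniteColimits (F j)
  leftExact : ∀ j, PreservesFiniteLimits (F j)
  conservative : ∃ I : Finset J, ∀ {Y X : C} (p : Y ⟶ X),
    (∀ i ∈ I, Function.Bijective ((F i).map p)) → IsIso p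

/-- Exact functors take epimorphisms to surjections and direct summands to complementary subsets. Of
strictness only the epimorphism is needed, and the fibrewise form is easy to transport along an
equivalence. -/
theorem IsGalois.isFibrewiseGalois (hF : IsGalois F) : IsFibrewiseGalois F where
  hasFiniteLimits := hF.hasFiniteLimits
  hasFiniteColimits := hF.hasFiniteColimits
  rightExact := hF.rightExact
  leftExact := hF.leftExact
  factorisation p := by
    obtain ⟨X', p', p'', hp, ⟨_, -⟩, _, X'', q, ⟨hq⟩⟩ := hF.factorisation p
    refine ⟨X', X'', p', p'', q, hp, fun j => ?_⟩
    have := hF.rightExact j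
    have := hF.leftExact j
    exact ⟨surjective_of_epi (F j) p', (Types.binaryCofan_isColimit_iff _).1
      ⟨mapIsColimitOfPreservesOfIsColimit (F j ⋙ FintypeCat.incl) _ _ hq⟩⟩
  conservative := by
    obtain ⟨I, hI⟩ := hF.conservative
    exact ⟨I, fun p hp => (hI p).2 fun i hi => (ProfGrpd.isIso_iff_bijective _).2 (hp i hi)⟩

/-- An object is connected if it has no nonempty proper subobjects. -/
def IsConn (F : J → C ⥤ FintypeCat.{u}) (P : C) : Prop :=
  ∀ {Z : C} (m : Z ⟶ P), (∀ j, Function.Injective ((F j).map m)) →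
    ∀ i, Nonempty ((F i).obj Z) → IsIso m

namespace IsFibrewiseGalois

theorem isIso_of_bijective (hF : IsFibrewiseGalois F) {X Y : C} (p : X ⟶ Y)
    (hp : ∀ j, Function.Bijective ((F j).map p)) : IsIso p := by
  obtain ⟨I, hI⟩ := hF.conservative
  exact hI p fun i _ => hp i

theorem map_injective (hF : IsFibrewiseGalois F) {X Y : C} {f g : X ⟶ Y}
    (h : ∀ j x, (F j).map f x = (F j).map g x) : f = g := by
  have := hF.hasFiniteLimits
  have : IsIso (equalizer.ι f g) := hF.isIso_of_bijective _ fun j => by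
    have := hF.leftExact j
    exact ⟨injective_of_mono (F j) _, fun x => exists_mem_equalizer (F j) (h j x)⟩
  exact (cancel_epi (equalizer.ι f g)).1 (equalizer.condition f g)

/-- Every point of an object lies in a connected subobject. -/
theorem exists_component (hF : IsFibrewiseGalois F) {X : C} {j : J} (x : (F j).obj X) :
    ∃ (P : C) (m : P ⟶ X) (p : (F j).obj P), IsConn F P ∧
      (∀ i, Function.Injective ((F i).map m)) ∧ (F j).map m p = x := by
  obtain ⟨I, hI⟩ := hF.conservative
  -- The component is a subobject through `x` whose fibres over the conservative set `I` have the
  -- least total size.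
  let S : Set ℕ := {n | ∃ (P : C) (m : P ⟶ X) (p : (F j).obj P),
    (∀ i, Function.Injective ((F i).map m)) ∧ (F j).map m p = x ∧
      n = ∑ i ∈ I, Nat.card ((F i).obj P)}
  have hS : S.Nonempty := ⟨_, X, 𝟙 X, x, fun i => (bijective_of_isIso (F i) _).1,
    ConcreteCategory.congr_hom ((F j).map_id X) x, rfl⟩
  obtain ⟨P, m, p, hm, hp, hN⟩ := Nat.sInf_mem hS
  -- By minimality a subobject of `P` through `p` has fibres of full size over `I`, so it is all of
  -- `P`.
  have key {Z : C} (k : Z ⟶ P) (hk : ∀ i, Function.Injective ((F i).map k))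
      (hz : p ∈ Set.range ((F j).map k)) : IsIso k := by
    obtain ⟨z, hz⟩ := hz
    refine hI k fun i hi => ?_
    have h₁ : ∑ i ∈ I, Nat.card ((F i).obj P) ≤ ∑ i ∈ I, Nat.card ((F i).obj Z) := by
      rw [← hN]
      refine Nat.sInf_le ⟨Z, k ≫ m, z, fun i a b hab => hk i (hm i ?_), ?_, rfl⟩
      · rwa [map_comp_apply, map_comp_apply] at hab
      · rw [map_comp_apply, hz, hp]
    have h₂ : ∀ i ∈ I, Nat.card ((F i).obj Z) ≤ Nat.card ((F i).obj P) := fun i _ =>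
      Nat.card_le_card_of_injective _ (hk i)
    exact (hk i).bijective_of_nat_card_le
      ((Finset.sum_eq_sum_iff_of_le h₂).1 (le_antisymm (Finset.sum_le_sum h₂) h₁) i hi).ge
  refine ⟨P, m, p, fun {Z} k hk i ⟨z⟩ => ?_, hm, hp⟩
  obtain ⟨Z', Z'', k', k'', q, hkk, H⟩ := hF.factorisation k
  by_cases hz : p ∈ Set.range ((F j).map k)
  · exact key k hk hz
  -- If the image of `k` misses `p`, its complement contains `p` and is all of `P`, although the
  -- image contains the point coming from `z`.
  · exfalso
    have hr : p ∉ Set.range ((F j).map k'') := by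
      rintro ⟨b, hb⟩
      obtain ⟨a, rfl⟩ := (H j).1 b
      exact hz ⟨a, by rw [← hkk, map_comp_apply, hb]⟩
    have hr' : p ∈ Set.range ((F j).map q) :=
      (((H j).2.2.2.sup_eq_top.ge (Set.mem_univ p) :
        p ∈ Set.range ((F j).map k'') ∪ Set.range ((F j).map q))).resolve_left hr
    have := key q (fun i => (H i).2.2.1) hr'
    obtain ⟨b, hb⟩ := (bijective_of_isIso (F i) q).2 ((F i).map k'' ((F i).map k' z))
    exact Set.disjoint_left.1 (H i).2.2.2.disjoint ⟨_, rfl⟩ ⟨b, hb⟩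

/-- The equaliser of `f` and `g` is a subobject of `P` with a point, hence all of `P`. A point is
supplied because objects with empty fibres satisfy `IsConn` vacuously. -/
theorem IsConn.hom_ext (hF : IsFibrewiseGalois F) {P : C} (hP : IsConn F P) {j : J}
    (p : (F j).obj P) {X : C} {f g : P ⟶ X} (h : (F j).map f p = (F j).map g p) : f = g := by
  have := hF.hasFiniteLimits
  have hle := hF.leftExact
  obtain ⟨z, -⟩ := exists_mem_equalizer (F j) h
  have : IsIso (equalizer.ι f g) := hP _ (fun i => injective_of_mono (F i) _) j ⟨z⟩
  exact (cancel_epi (equalizer.ι f g)).1 (equalizer.condition f g)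

theorem IsConn.surjective (hF : IsFibrewiseGalois F) {P X : C} (hX : IsConn F X) (f : P ⟶ X) {i : J}
    (p : (F i).obj P) (j : J) : Function.Surjective ((F j).map f) := by
  obtain ⟨X', X'', f', f'', q, rfl, H⟩ := hF.factorisation f
  have : IsIso f'' := hX f'' (fun i => (H i).2.1) i ⟨(F i).map f' p⟩
  intro x
  obtain ⟨y, rfl⟩ := (bijective_of_isIso (F j) f'').2 x
  obtain ⟨z, rfl⟩ := (H j).1 y
  exact ⟨z, map_comp_apply _ _ _ _⟩

/-- Finitely many points are images of a single point of a connected object. -/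
theorem exists_conn (hF : IsFibrewiseGalois F) {j : J} {K : Type*} [Finite K] (Y : K → C)
    (y : ∀ k, (F j).obj (Y k)) :
    ∃ (P : C) (p : (F j).obj P), IsConn F P ∧ ∀ k, ∃ f : P ⟶ Y k, (F j).map f p = y k := by
  have := hF.hasFiniteLimits
  have := hF.leftExact j
  obtain ⟨z, hz⟩ := exists_mem_pi (F j) Y y
  obtain ⟨P, m, p, hP, -, hp⟩ := hF.exists_component z
  exact ⟨P, p, hP, fun k => ⟨m ≫ Pi.π Y k, by rw [map_comp_apply, hp, hz]⟩⟩

/-! ### Natural transformations between fibre functors -/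

/-- Points of a connected object are carried into each other by natural transformations of fibre
functors. -/
theorem exists_natTrans (hF : IsFibrewiseGalois F) {X : C} (hX : IsConn F X) {i j : J}
    (s : (F i).obj X) (t : (F j).obj X) : ∃ τ : F i ⟶ F j, τ.app X s = t := by
  classical
  -- Provides the default values of the approximate transformations `α` below.
  have hne (a : Σ Y : C, (F i).obj Y) : Nonempty ((F j).obj a.1) := by
    obtain ⟨P, p, hP, hf⟩ := hF.exists_conn (j := i) (K := Bool) (fun k => bif k then a.1 else X)
      (fun k => match k with | true => a.2 | false => s)
    obtain ⟨q, -⟩ := IsConn.surjective hF hX (hf false).choose p j t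
    exact ⟨(F j).map (hf true).choose q⟩
  let _ (Y : C) : TopologicalSpace ((F j).obj Y) := ⊥
  have (Y : C) : DiscreteTopology ((F j).obj Y) := ⟨rfl⟩
  have hs : IsCompact {α : ∀ a : Σ Y : C, (F i).obj Y, (F j).obj a.1 | α ⟨X, s⟩ = t} :=
    (isClosed_singleton.preimage (continuous_apply (A := fun a : Σ Y : C, (F i).obj Y =>
      ((F j).obj a.1 : Type u)) ⟨X, s⟩)).isCompact
  -- A transformation is a point of the compact product of the `F j` fibres satisfying the closed
  -- naturality conditions. It suffices to meet finitely many of them together with the condition at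
  -- `s`.
  obtain ⟨α, hα, hα'⟩ := hs.inter_iInter_nonempty
    (fun k : Σ (Y Y' : C) (_ : Y ⟶ Y'), (F i).obj Y =>
      {α | (F j).map k.2.2.1 (α ⟨k.1, k.2.2.2⟩) = α ⟨k.2.1, (F i).map k.2.2.1 k.2.2.2⟩})
    (fun k => isClosed_eq (continuous_of_discreteTopology.comp (continuous_apply
      (A := fun a : Σ Y : C, (F i).obj Y => ((F j).obj a.1 : Type u)) _)) (continuous_apply _))
    fun S => by
      obtain ⟨P, p, hP, hf⟩ := hF.exists_conn (j := i) (K := Option S)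
        (fun k => match k with | none => X | some k => k.1.1)
        (fun k => match k with | none => s | some k => k.1.2.2.2)
      obtain ⟨f₀, hf₀⟩ := hf none
      obtain ⟨q, hq⟩ := IsConn.surjective hF hX f₀ p j t
      -- All points in question are images of `p`. Choosing `q` above `t` and sending the image of
      -- `p` under `f` to the image of `q` under `f` is well defined, as `f` is determined by its
      -- value at `p`.
      let α : ∀ a : Σ Y : C, (F i).obj Y, (F j).obj a.1 := fun a =>
        if h : ∃ f : P ⟶ a.1, (F i).map f p = a.2 then (F j).map h.choose q else (hne a).some
      have hα {Y : C} (f : P ⟶ Y) {y : (F i).obj Y} (hy : (F i).map f p = y) :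
          α ⟨Y, y⟩ = (F j).map f q := by
        have h : ∃ f : P ⟶ Y, (F i).map f p = y := ⟨f, hy⟩
        have : h.choose = f := IsConn.hom_ext hF hP p (h.choose_spec.trans hy.symm)
        exact (dif_pos h).trans (by rw [this])
      refine ⟨α, (hα f₀ hf₀).trans hq, Set.mem_iInter₂.2 fun k hk => ?_⟩
      obtain ⟨f, hfk⟩ := hf (some ⟨k, hk⟩)
      change (F j).map k.2.2.1 (α ⟨k.1, k.2.2.2⟩) = α ⟨k.2.1, (F i).map k.2.2.1 k.2.2.2⟩
      rw [hα f hfk, hα (f ≫ k.2.2.1) (by rw [map_comp_apply]; exact congrArg _ hfk), map_comp_apply]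
  refine ⟨{ app Y := FintypeCat.homMk fun y => α ⟨Y, y⟩, naturality Y Y' f := ?_ }, hα⟩
  ext y
  exact (Set.mem_iInter.1 hα' ⟨Y, Y', f, y⟩).symm

/-- Write `s` and `s'` as images of one point `p` of a connected object under `f` and `g`. If `τ`
identifies them, `f` and `g` agree at `τ p`, so they are equal. -/
theorem injective_app (hF : IsFibrewiseGalois F) {i j : J} (τ : F i ⟶ F j) (X : C) :
    Function.Injective (τ.app X) := by
  intro s s' h
  obtain ⟨P, p, hP, hf⟩ := hF.exists_conn (j := i) (K := Bool) (fun _ => X)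
    (fun k => bif k then s else s')
  obtain ⟨f, hf₁⟩ := hf true
  obtain ⟨g, hg₁⟩ := hf false
  change _ = s at hf₁
  change _ = s' at hg₁
  have : f = g := IsConn.hom_ext hF hP (τ.app P p) (by
    rw [← FunctorToFintypeCat.naturality, ← FunctorToFintypeCat.naturality, hf₁, hg₁, h])
  rw [← hf₁, ← hg₁, this]

/-- The image `U` of `X` in the terminal object has a complement `V`. A point of `V` under `F i`
would be carried by `τ` to one under `F j`, where `U` already fills the one-point fibre; so `F i`
has a point on `U`, and it lifts to `X`. -/
theorem nonempty_of_natTrans (hF : IsFibrewiseGalois F) {i j : J} (τ : F i ⟶ F j) {X : C}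
    (x : (F j).obj X) : Nonempty ((F i).obj X) := by
  have := hF.hasFiniteLimits
  have := hF.leftExact
  let T : PEmpty.{1} → C := PEmpty.elim
  obtain ⟨U, V, p', p'', q, -, H⟩ := hF.factorisation (Pi.lift (f := T) (P := X) fun k => k.elim)
  obtain ⟨z, -⟩ := exists_mem_pi (F i) T fun k => k.elim
  rcases (H i).2.2.2.sup_eq_top.ge (Set.mem_univ z) with ⟨y, -⟩ | ⟨y, -⟩
  · obtain ⟨x, -⟩ := (H i).1 y
    exact ⟨x⟩
  · refine (Set.disjoint_left.1 (H j).2.2.2.disjoint ⟨(F j).map p' x, rfl⟩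
      ⟨τ.app V y, ?_⟩).elim
    exact pi_ext (F j) T fun k => k.elim

/-- For a point `t` of the target, its component has points under both functors, so there is also a
transformation in the reverse direction. Both are injective, so the finite fibres have equal size.
-/
theorem bijective_app (hF : IsFibrewiseGalois F) {i j : J} (τ : F i ⟶ F j) (X : C) :
    Function.Bijective (τ.app X) := by
  refine ⟨hF.injective_app τ X, fun t => ?_⟩
  obtain ⟨P, m, p, hP, -, -⟩ := hF.exists_component t
  obtain ⟨s⟩ := hF.nonempty_of_natTrans τ p
  obtain ⟨σ, -⟩ := hF.exists_natTrans hP p s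
  exact ((hF.injective_app τ X).bijective_of_nat_card_le
    (Nat.card_le_card_of_injective _ (hF.injective_app σ X))).2 t

theorem isIso_natTrans (hF : IsFibrewiseGalois F) {i j : J} (τ : F i ⟶ F j) : IsIso τ := by
  have (X : C) : IsIso (τ.app X) := (ProfGrpd.isIso_iff_bijective _).2 (hF.bijective_app τ X)
  exact NatIso.isIso_of_isIso_app τ

/-- Every fibre functor is isomorphic to one of finitely many fibre functors. -/
theorem exists_finset_natTrans (hF : IsFibrewiseGalois F) :
    ∃ I : Finset J, ∀ j, ∃ i ∈ I, Nonempty (F i ⟶ F j) := by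
  obtain ⟨I, hI⟩ := hF.conservative
  have := hF.hasFiniteColimits
  have := hF.rightExact
  refine ⟨I, fun j => ?_⟩
  -- The empty family yields a connected object with a point under `F j`. If its fibres over `I`
  -- were all empty, it would be initial by conservativity and could have no point.
  obtain ⟨Q, q, hQ, -⟩ := hF.exists_conn (j := j) (K := PEmpty.{1}) (fun k => k.elim)
    (fun k => k.elim)
  have hex : ∃ i ∈ I, Nonempty ((F i).obj Q) := by
    by_contra! h
    let T : PEmpty.{1} → C := PEmpty.elim
    have : IsIso (Sigma.desc (f := T) (P := Q) fun k => k.elim) := hI _ fun i hi => by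
      have := h i hi
      have := Function.isEmpty ((F i).map (Sigma.desc (f := T) (P := Q) fun k => k.elim))
      exact ⟨Function.injective_of_subsingleton _, fun y => isEmptyElim y⟩
    obtain ⟨z, -⟩ := (bijective_of_isIso (F j) (Sigma.desc (f := T) (P := Q) fun k => k.elim)).2 q
    obtain ⟨k, -⟩ := exists_of_mem_sigma (F j) T z
    exact k.elim
  obtain ⟨i, hi, ⟨s⟩⟩ := hex
  obtain ⟨τ, -⟩ := hF.exists_natTrans hQ s q
  exact ⟨i, hi, ⟨τ⟩⟩

end IsFibrewiseGalois

end FinConnGalois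

/-! ### The fundamental groupoid of a Galois category -/

/-- A topological groupoid with profinite hom-spaces and finitely many isomorphism classes of
objects is equivalent to a finite coproduct of profinite groups. -/
theorem ProfGrpd.exists_equivalence_sigma {O : Type u} [Groupoid.{u} O]
    [∀ x y : O, TopologicalSpace (x ⟶ y)] [∀ x y : O, CompactSpace (x ⟶ y)]
    [∀ x y : O, TotallyDisconnectedSpace (x ⟶ y)]
    (hcomp : ∀ x y z : O, Continuous fun g : (x ⟶ y) × (y ⟶ z) => g.1 ≫ g.2)
    (hinv : ∀ x y : O, Continuous fun g : x ⟶ y => Groupoid.inv g)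
    (I : Finset O) (hI : ∀ x, ∃ y ∈ I, Nonempty (y ⟶ x)) :
    ∃ (n : ℕ) (G : Fin n → ProfiniteGrp.{u}) (e : (Σ i, SingleObj (G i)) ≌ O), ∀ i,
      Continuous fun g : G i => e.functor.map (Sigma.SigmaHom.mk (SingleObj.toEnd (G i) g)) := by
  let s : Setoid O :=
    { r x y := Nonempty (x ⟶ y)
      iseqv := ⟨fun x => ⟨𝟙 x⟩, fun ⟨g⟩ => ⟨Groupoid.inv g⟩, fun ⟨g⟩ ⟨h⟩ => ⟨g ≫ h⟩⟩ }
  have hfin : Finite (Quotient s) := by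
    refine Finite.of_surjective (fun y : I => Quotient.mk s y.1) fun q => ?_
    obtain ⟨x, rfl⟩ := Quotient.mk_surjective q
    obtain ⟨y, hy, h⟩ := hI x
    exact ⟨⟨y, hy⟩, Quotient.sound h⟩
  let c : Quotient s ≃ Fin (Nat.card (Quotient s)) := Finite.equivFin _
  let r (i : Fin (Nat.card (Quotient s))) : O := (c.symm i).out
  -- One representative per class: distinct representatives have no morphisms between them, which
  -- makes `E` full.
  have hr {i j} (g : r i ⟶ r j) : i = j := c.symm.injective (Quotient.out_equiv_out.1 ⟨g⟩)
  let _ (x : O) : TopologicalSpace (End x) := inferInstanceAs (TopologicalSpace (x ⟶ x))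
  have (x : O) : CompactSpace (End x) := inferInstanceAs (CompactSpace (x ⟶ x))
  have (x : O) : TotallyDisconnectedSpace (End x) :=
    inferInstanceAs (TotallyDisconnectedSpace (x ⟶ x))
  have (x : O) : IsTopologicalGroup (End x) :=
    { continuous_mul := (hcomp x x x).comp continuous_swap
      continuous_inv := hinv x x }
  let G (i : Fin (Nat.card (Quotient s))) : ProfiniteGrp.{u} := ProfiniteGrp.of (End (r i))
  let E : (Σ i, SingleObj (G i)) ⥤ O :=
    Sigma.desc fun i => SingleObj.functor (MonoidHom.id (End (r i)))
  have hfaith : E.Faithful := ⟨by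
    rintro ⟨i, _⟩ _ ⟨g⟩ f h
    rcases f with ⟨f⟩
    exact congrArg Sigma.SigmaHom.mk h⟩
  have hfull : E.Full := ⟨by
    rintro ⟨i, _⟩ ⟨j, _⟩ (g : r i ⟶ r j)
    obtain rfl := hr g
    exact ⟨Sigma.SigmaHom.mk (show End (r i) from g), rfl⟩⟩
  have hess : E.EssSurj := ⟨fun x => by
    refine ⟨⟨c (Quotient.mk s x), SingleObj.star _⟩, ?_⟩
    obtain ⟨g⟩ : Nonempty (r (c (Quotient.mk s x)) ⟶ x) := by
      have h : Nonempty ((Quotient.mk s x).out ⟶ x) := Quotient.mk_out (s := s) x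
      simpa only [r, Equiv.symm_apply_apply] using h
    exact ⟨Groupoid.isoEquivHom _ _ |>.symm g⟩⟩
  have : E.IsEquivalence := {}
  exact ⟨_, G, E.asEquivalence, fun i => continuous_id⟩

namespace FinConnGalois

/-! ### The profinite topology on natural transformations -/

section Topology

variable {C : Type v} [Category.{w} C] {J : Type u₁} {F G : C ⥤ FintypeCat.{u}}

/-- The values of a natural transformation. -/
def natValues (τ : F ⟶ G) (a : Σ Y : C, F.obj Y) : G.obj a.1 := τ.app a.1 a.2

/-- The topology of pointwise convergence on natural transformations. -/
@[reducible]
def natTopology (F G : C ⥤ FintypeCat.{u}) : TopologicalSpace (F ⟶ G) :=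
  .induced natValues (@Pi.topologicalSpace _ _ fun _ => ⊥)

attribute [local instance] natTopology

theorem natValues_injective : Function.Injective (natValues (F := F) (G := G)) := fun _ _ h =>
  NatTrans.ext (funext fun Y => FintypeCat.hom_ext _ _ fun y => congrFun h ⟨Y, y⟩)

/-- Naturality is a family of closed conditions on the product of the discrete finite fibres, so the
space of transformations inherits compactness, separation and total disconnectedness. -/
theorem natValues_isClosedEmbedding :
    let _ (Y : C) : TopologicalSpace (G.obj Y) := ⊥
    Topology.IsClosedEmbedding (natValues (F := F) (G := G)) := by
  intro _
  have (Y : C) : DiscreteTopology (G.obj Y) := ⟨rfl⟩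
  refine ⟨⟨⟨rfl⟩, natValues_injective⟩, ?_⟩
  have : Set.range (natValues (F := F) (G := G)) =
      ⋂ k : Σ (Y Y' : C) (_ : Y ⟶ Y'), F.obj Y,
        {α | G.map k.2.2.1 (α ⟨k.1, k.2.2.2⟩) = α ⟨k.2.1, F.map k.2.2.1 k.2.2.2⟩} := by
    ext α
    rw [Set.mem_iInter]
    constructor
    · rintro ⟨τ, rfl⟩ k
      exact (FunctorToFintypeCat.naturality F G τ k.2.2.1 k.2.2.2).symm
    · intro hα
      refine ⟨{ app Y := FintypeCat.homMk fun y => α ⟨Y, y⟩, naturality Y Y' f := ?_ }, rfl⟩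
      ext y
      exact (hα ⟨Y, Y', f, y⟩).symm
  rw [this]
  exact isClosed_iInter fun k => isClosed_eq (continuous_of_discreteTopology.comp (continuous_apply
      (A := fun a : Σ Y : C, F.obj Y => (G.obj a.1 : Type u)) _)) (continuous_apply _)

theorem compactSpace_nat : CompactSpace (F ⟶ G) := by
  let _ (Y : C) : TopologicalSpace (G.obj Y) := ⊥
  have (Y : C) : DiscreteTopology (G.obj Y) := ⟨rfl⟩
  exact (natValues_isClosedEmbedding (F := F) (G := G)).compactSpace

theorem t2Space_nat : T2Space (F ⟶ G) := by
  let _ (Y : C) : TopologicalSpace (G.obj Y) := ⊥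
  have (Y : C) : DiscreteTopology (G.obj Y) := ⟨rfl⟩
  exact (natValues_isClosedEmbedding (F := F) (G := G)).isEmbedding.t2Space

theorem totallyDisconnectedSpace_nat : TotallyDisconnectedSpace (F ⟶ G) := by
  let _ (Y : C) : TopologicalSpace (G.obj Y) := ⊥
  have (Y : C) : DiscreteTopology (G.obj Y) := ⟨rfl⟩
  exact (natValues_isClosedEmbedding (F := F) (G := G)).isEmbedding.isTotallyDisconnected_range.1
    (isTotallyDisconnected_of_totallyDisconnectedSpace _)

theorem isLocallyConstant_app (Y : C) (y : F.obj Y) :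
    IsLocallyConstant fun τ : F ⟶ G => τ.app Y y := by
  let _ (Y : C) : TopologicalSpace (G.obj Y) := ⊥
  have (Y : C) : DiscreteTopology (G.obj Y) := ⟨rfl⟩
  exact IsLocallyConstant.iff_continuous _ |>.2 ((continuous_apply
    (A := fun a : Σ Y : C, F.obj Y => (G.obj a.1 : Type u)) ⟨Y, y⟩).comp
      (natValues_isClosedEmbedding (F := F) (G := G)).continuous)

theorem continuous_nat {T : Type*} [TopologicalSpace T] {f : T → (F ⟶ G)}
    (hf : ∀ Y y, IsLocallyConstant fun t => (f t).app Y y) : Continuous f := by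
  let _ (Y : C) : TopologicalSpace (G.obj Y) := ⊥
  exact continuous_induced_rng.2 (continuous_pi fun a => (hf a.1 a.2).continuous)

/-- The values at finitely many points determine a neighbourhood. -/
theorem exists_finset_of_isOpen {U : Set (F ⟶ G)} (hU : IsOpen U) {τ : F ⟶ G} (hτ : τ ∈ U) :
    ∃ S : Finset (Σ Y : C, F.obj Y),
      ∀ σ : F ⟶ G, (∀ a ∈ S, σ.app a.1 a.2 = τ.app a.1 a.2) → σ ∈ U := by
  let _ (Y : C) : TopologicalSpace (G.obj Y) := ⊥
  obtain ⟨V, hV, rfl⟩ := isOpen_induced_iff.1 hU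
  obtain ⟨S, W, hW, hWV⟩ := isOpen_pi_iff.1 hV _ hτ
  refine ⟨S, fun σ hσ => hWV fun a ha => ?_⟩
  have : natValues σ a = natValues τ a := hσ a ha
  rw [this]
  exact (hW a ha).2

end Topology

/-! ### Construction of the fundamental groupoid -/

variable {C : Type u} [Category.{u} C] {J : Type u} {F : J → C ⥤ FintypeCat.{u}}

namespace IsFibrewiseGalois

attribute [local instance] natTopology compactSpace_nat t2Space_nat totallyDisconnectedSpace_nat

/-- The groupoid of fibre functors. -/
@[reducible]
def groupoid (hF : IsFibrewiseGalois F) : Groupoid.{u} J where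
  Hom i j := F i ⟶ F j
  id i := 𝟙 (F i)
  comp σ τ := NatTrans.vcomp σ τ
  inv {i j} σ :=
    haveI := hF.isIso_natTrans σ
    CategoryTheory.inv (C := C ⥤ FintypeCat.{u}) σ
  inv_comp σ :=
    haveI := hF.isIso_natTrans σ
    IsIso.inv_hom_id (C := C ⥤ FintypeCat.{u}) σ
  comp_inv σ :=
    haveI := hF.isIso_natTrans σ
    IsIso.hom_inv_id (C := C ⥤ FintypeCat.{u}) σ

theorem continuous_groupoid_comp (i j k : J) :
    Continuous fun g : (F i ⟶ F j) × (F j ⟶ F k) => g.1 ≫ g.2 := by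
  refine continuous_nat fun Y y => ?_
  refine .of_finite_family (ι := Option ((F j).obj Y)) (β := fun k' => match k' with
      | none => (F j).obj Y
      | some _ => (F k).obj Y)
    (fun k' => match k' with
      | none => fun g => g.1.app Y y
      | some z => fun g => g.2.app Y z) (fun k' => ?_) fun g h hgh => ?_
  · cases k' with
    | none => exact (isLocallyConstant_app Y y).comp_continuous continuous_fst
    | some z => exact (isLocallyConstant_app Y z).comp_continuous continuous_snd
  · change g.2.app Y (g.1.app Y y) = h.2.app Y (h.1.app Y y)
    have h₁ : g.1.app Y y = h.1.app Y y := hgh none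
    rw [h₁]
    exact hgh (some _)

/-- The value of the inverse of `g` at `y` is determined by the values of `g` on the finite fibre
over `Y`. -/
theorem continuous_groupoid_inv (hF : IsFibrewiseGalois F) (i j : J) :
    Continuous fun g : F i ⟶ F j =>
      haveI := hF.isIso_natTrans g
      CategoryTheory.inv (C := C ⥤ FintypeCat.{u}) g := by
  have := fun {i j} => hF.isIso_natTrans (i := i) (j := j)
  refine continuous_nat fun Y y => ?_
  refine .of_finite_family (fun (z : (F i).obj Y) g => g.app Y z)
    (fun z => isLocallyConstant_app Y z) fun g h hgh => hF.injective_app g Y ?_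
  have key (g : F i ⟶ F j) : g.app Y ((inv g).app Y y) = y :=
    ConcreteCategory.congr_hom (congrArg (fun t => NatTrans.app t Y) (IsIso.inv_hom_id g)) y
  have h' : g.app Y ((inv h).app Y y) = h.app Y ((inv h).app Y y) := hgh _
  rw [key, h', key]

/-- The fundamental groupoid: its objects are the fibre functors, its morphisms are the natural
transformations between them. -/
def fundamentalGroupoid (hF : IsFibrewiseGalois F) : ProfGrpd.{u} where
  obj := J
  grpd := hF.groupoid
  top i j := natTopology (F i) (F j)
  compact i j := compactSpace_nat
  hausdorff i j := t2Space_nat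
  totallyDisconnected i j := totallyDisconnectedSpace_nat
  continuous_comp := continuous_groupoid_comp
  continuous_inv := hF.continuous_groupoid_inv
  finitelyConnected := by
    obtain ⟨I, hI⟩ := hF.exists_finset_natTrans
    let _ := hF.groupoid
    let _ (i j : J) : TopologicalSpace (i ⟶ j) := natTopology (F i) (F j)
    have (i j : J) : CompactSpace (i ⟶ j) := compactSpace_nat (F := F i) (G := F j)
    have (i j : J) : TotallyDisconnectedSpace (i ⟶ j) :=
      totallyDisconnectedSpace_nat (F := F i) (G := F j)
    exact ProfGrpd.exists_equivalence_sigma (O := J) continuous_groupoid_comp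
      hF.continuous_groupoid_inv I hI

open ProfGrpd

/-- A fibre functor, as an object of the fundamental groupoid. -/
def pt (hF : IsFibrewiseGalois F) (j : J) : hF.fundamentalGroupoid.obj := j

/-- A natural transformation of fibre functors, as a morphism of the fundamental groupoid. -/
def path (hF : IsFibrewiseGalois F) {i j : J} (τ : F i ⟶ F j) : hF.pt i ⟶ hF.pt j := τ

theorem path_id (hF : IsFibrewiseGalois F) (j : J) : hF.path (𝟙 (F j)) = 𝟙 (hF.pt j) := rfl

theorem path_comp (hF : IsFibrewiseGalois F) {i j k : J} (σ : F i ⟶ F j) (τ : F j ⟶ F k) :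
    hF.path (σ ≫ τ) = hF.path σ ≫ hF.path τ := rfl

/-! ### The equivalence with actions of the fundamental groupoid -/

/-- The fibres of an object, with the action of the fundamental groupoid. -/
def fibres (hF : IsFibrewiseGalois F) : C ⥤ FSets hF.fundamentalGroupoid where
  obj X :=
    { obj :=
        { obj j := (F j).obj X
          map {i j} τ := NatTrans.app (show F i ⟶ F j from τ) X
          map_id _ := rfl
          map_comp _ _ := rfl }
      property _ _ := isLocallyConstant_hom fun s => isLocallyConstant_app X s }
  map f := ObjectProperty.homMk
    { app j := (F j).map f
      naturality i j τ := (NatTrans.naturality (show F i ⟶ F j from τ) f).symm }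
  map_id X := FSets.hom_ext fun j s => ConcreteCategory.congr_hom ((F j).map_id X) s
  map_comp f g := FSets.hom_ext fun j s => ConcreteCategory.congr_hom ((F j).map_comp f g) s

instance fibres_faithful (hF : IsFibrewiseGalois F) : hF.fibres.Faithful where
  map_injective h := hF.map_injective fun j x =>
    ConcreteCategory.congr_hom (congrArg (fibre hF.fundamentalGroupoid j).map h) x

/-- Stable subsets of the fibres of an object come from subobjects. -/
theorem exists_subobject (hF : IsFibrewiseGalois F) {Z : C} (S : ∀ j, Set ((F j).obj Z))
    (hS : ∀ {i j} (τ : F i ⟶ F j) s, s ∈ S i → τ.app Z s ∈ S j) :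
    ∃ (W : C) (m : W ⟶ Z), ∀ j, Function.Injective ((F j).map m) ∧
      Set.range ((F j).map m) = S j := by
  have := hF.hasFiniteColimits
  have := hF.rightExact
  obtain ⟨I, hI⟩ := hF.exists_finset_natTrans
  -- The subobject is the image of the coproduct of the components of the points of `S` over `I`, a
  -- finite family. Transformations sweep out each component from its chosen point, and carry points
  -- over `I` to points over every `j`.
  choose P m p hP _ hp using fun k : Σ i : I, S i => hF.exists_component (j := k.1.1) k.2.1
  obtain ⟨W, W', f', f'', q, hf, H⟩ := hF.factorisation (Sigma.desc m)
  refine ⟨W, f'', fun j => ⟨(H j).2.1, subset_antisymm ?_ fun t ht => ?_⟩⟩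
  · rintro _ ⟨w, rfl⟩
    obtain ⟨y, rfl⟩ := (H j).1 w
    obtain ⟨k, y, rfl⟩ := exists_of_mem_sigma (F j) _ y
    rw [← map_comp_apply, hf, ← map_comp_apply, Sigma.ι_desc]
    obtain ⟨τ, rfl⟩ := hF.exists_natTrans (hP k) (p k) y
    rw [← FunctorToFintypeCat.naturality, hp]
    exact hS τ _ k.2.2
  · obtain ⟨i, hi, ⟨τ⟩⟩ := hI j
    obtain ⟨s, rfl⟩ := (hF.bijective_app τ Z).2 t
    have hs : s ∈ S i := by
      have := hF.isIso_natTrans τ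
      have h := hS (inv τ) _ ht
      rwa [← ConcreteCategory.comp_apply, ← NatTrans.comp_app, IsIso.hom_inv_id,
        NatTrans.id_app, FintypeCat.id_apply] at h
    let k : Σ i : I, S i := ⟨⟨i, hi⟩, ⟨s, hs⟩⟩
    refine ⟨τ.app W ((F i).map f' ((F i).map (Sigma.ι P k) (p k))), ?_⟩
    rw [← FunctorToFintypeCat.naturality, ← map_comp_apply, hf, ← map_comp_apply, Sigma.ι_desc]
    exact congrArg (τ.app Z) (hp k)

/-- The graph of `α` is a stable subset of the fibres of `X ⨯ Y`, so it is a subobject `W`. Its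
projection to `X` is bijective on fibres, hence invertible, and composing the inverse with the other
projection realises `α`. -/
instance fibres_full (hF : IsFibrewiseGalois F) : hF.fibres.Full where
  map_surjective {X Y} α := by
    have := hF.hasFiniteLimits
    have := hF.leftExact
    obtain ⟨W, m, hm⟩ := hF.exists_subobject (Z := X ⨯ Y)
      (fun j => {z | α.hom.app j ((F j).map prod.fst z) = (F j).map prod.snd z})
      fun {i j} τ s hs => by
        change α.hom.app j ((F j).map prod.fst (τ.app _ s)) = (F j).map prod.snd (τ.app _ s)
        rw [← FunctorToFintypeCat.naturality, ← FunctorToFintypeCat.naturality]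
        exact (FSets.naturality α (hF.path τ) _).trans (congrArg (τ.app Y) hs)
    have hW (j) (w : (F j).obj W) :
        α.hom.app j ((F j).map prod.fst ((F j).map m w)) = (F j).map prod.snd ((F j).map m w) :=
      (hm j).2.le ⟨w, rfl⟩
    have : IsIso (m ≫ prod.fst) := hF.isIso_of_bijective _ fun j => by
      refine ⟨fun w w' h => (hm j).1 ?_, fun x => ?_⟩
      · rw [map_comp_apply, map_comp_apply] at h
        refine prod_ext (F j) h ?_
        rw [← hW, ← hW, h]
      · obtain ⟨z, hz₁, hz₂⟩ := exists_mem_prod (F j) x (α.hom.app j x : (F j).obj Y)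
        obtain ⟨w, rfl⟩ := (hm j).2.ge (show α.hom.app j ((F j).map prod.fst z) =
          (F j).map prod.snd z by rw [hz₁, hz₂])
        exact ⟨w, by rw [map_comp_apply, hz₁]⟩
    refine ⟨inv (m ≫ prod.fst) ≫ m ≫ prod.snd, FSets.hom_ext fun (j : J) (x : (F j).obj X) => ?_⟩
    obtain ⟨w, rfl⟩ := (bijective_of_isIso (F j) (m ≫ prod.fst)).2 x
    change (F j).map (inv (m ≫ prod.fst) ≫ m ≫ prod.snd) ((F j).map (m ≫ prod.fst) w) =
      α.hom.app j ((F j).map (m ≫ prod.fst) w)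
    rw [← map_comp_apply, IsIso.hom_inv_id_assoc, map_comp_apply, map_comp_apply, hW]

instance fibres_preservesFiniteColimits (hF : IsFibrewiseGalois F) :
    PreservesFiniteColimits hF.fibres where
  preservesFiniteColimits K _ _ := by
    have : PreservesColimitsOfShape K
        (hF.fibres ⋙ (isContinuousAction hF.fundamentalGroupoid).ι) :=
      preservesColimitsOfShape_of_evaluation _ _ fun j =>
        have := hF.rightExact j
        inferInstanceAs (PreservesColimitsOfShape K (F j))
    exact preservesColimitsOfShape_of_reflects_of_preserves _
      (isContinuousAction hF.fundamentalGroupoid).ι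

/-- Every point of an action is the image of a point of the fibres of an object. -/
theorem exists_hom_fibres (hF : IsFibrewiseGalois F) (T : FSets hF.fundamentalGroupoid) {i : J}
    (t : T.obj.obj (hF.pt i)) :
    ∃ (P : C) (p : (F i).obj P) (e : hF.fibres.obj P ⟶ T), e.hom.app (hF.pt i) p = t := by
  have hopen : IsOpen {g : F i ⟶ F i | T.obj.map (hF.path g) = T.obj.map (hF.path (𝟙 (F i)))} :=
    (T.property (hF.pt i) (hF.pt i)).isOpen_fiber _
  -- Automorphisms fixing finitely many points act trivially on `T` at `i`. With those points all
  -- images of `p`, the stabiliser of `p` fixes `t`, so the image of `p` under `τ` may be sent to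
  -- the image of `t` under `τ`.
  obtain ⟨S, hS⟩ := exists_finset_of_isOpen hopen rfl
  obtain ⟨P, p, hP, hf⟩ := hF.exists_conn (j := i) (K := S) (fun k => k.1.1) (fun k => k.1.2)
  have hid (g : F i ⟶ F i) (hg : g.app P p = p) : T.obj.map (hF.path g) t = t := by
    have h : T.obj.map (hF.path g) = T.obj.map (hF.path (𝟙 (F i))) := hS g fun a ha => by
      obtain ⟨f, hf⟩ := hf ⟨a, ha⟩
      change (F i).map f p = a.2 at hf
      rw [← hf, FunctorToFintypeCat.naturality, hg]
      rfl
    rw [h, path_id, T.obj.map_id, FintypeCat.id_apply]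
  have hwd {j : J} (σ τ : F i ⟶ F j) (h : σ.app P p = τ.app P p) :
      T.obj.map (hF.path σ) t = T.obj.map (hF.path τ) t := by
    have := hF.isIso_natTrans τ
    have h₁ := hid (σ ≫ inv τ) (by
      change (inv τ).app P (σ.app P p) = p
      rw [h, ← ConcreteCategory.comp_apply, ← NatTrans.comp_app, IsIso.hom_inv_id,
        NatTrans.id_app, FintypeCat.id_apply])
    have h₂ : hF.path (σ ≫ inv τ) ≫ hF.path τ = hF.path σ := by
      rw [← path_comp, Category.assoc, IsIso.inv_hom_id, Category.comp_id]
    rw [← h₂, T.obj.map_comp, ConcreteCategory.comp_apply, h₁]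
  choose ρ hρ using fun (j : J) (q : (F j).obj P) => hF.exists_natTrans hP p q
  have hρ' {j k : J} (τ : F j ⟶ F k) (q : (F j).obj P) :
      T.obj.map (hF.path (ρ k (τ.app P q))) t = T.obj.map (hF.path τ)
        (T.obj.map (hF.path (ρ j q)) t) := by
    rw [← ConcreteCategory.comp_apply, ← T.obj.map_comp, ← path_comp]
    exact hwd _ _ ((hρ _ _).trans (congrArg (τ.app P) (hρ j q).symm))
  exact ⟨P, p, ObjectProperty.homMk
    { app j := FintypeCat.homMk fun q => T.obj.map (hF.path (ρ j q)) t
      naturality j k τ := by ext q; exact hρ' τ q }, hid _ (hρ i p)⟩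

/-- Every action is a quotient of the fibres of an object. -/
theorem exists_surjection_fibres (hF : IsFibrewiseGalois F) (T : FSets hF.fundamentalGroupoid) :
    ∃ (X : C) (e : hF.fibres.obj X ⟶ T), ∀ j, Function.Surjective (e.hom.app j) := by
  have := hF.hasFiniteColimits
  obtain ⟨I, hI⟩ := hF.exists_finset_natTrans
  choose P p e he using fun k : Σ i : I, T.obj.obj (hF.pt i.1) =>
    hF.exists_hom_fibres T (i := k.1.1) k.2
  let hl := isColimitCofanMkObjOfIsColimit hF.fibres P _ (coproductIsCoproduct P)
  let d : hF.fibres.obj (∐ P) ⟶ T := hl.desc (Cofan.mk T e)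
  have hd (k) : hF.fibres.map (Sigma.ι P k) ≫ d = e k := hl.fac (Cofan.mk T e) ⟨k⟩
  refine ⟨∐ P, d, fun j t => ?_⟩
  obtain ⟨i, hi, ⟨τ⟩⟩ := hI j
  have hτ : IsIso (T.obj.map (hF.path τ)) := inferInstance
  obtain ⟨s, rfl⟩ : ∃ s, T.obj.map (hF.path τ) s = t := ((ProfGrpd.isIso_iff_bijective _).1 hτ).2 t
  let k : Σ i : I, T.obj.obj (hF.pt i.1) := ⟨⟨i, hi⟩, s⟩
  refine ⟨(hF.fibres.obj _).obj.map (hF.path τ)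
    ((hF.fibres.map (Sigma.ι P k)).hom.app (hF.pt i) (p k)), ?_⟩
  refine (FSets.naturality d (hF.path τ) _).trans (congrArg (T.obj.map (hF.path τ)) ?_)
  exact (ConcreteCategory.congr_hom (congrArg (fibre hF.fundamentalGroupoid i).map (hd k))
    (p k)).trans (he k)

/-- Choose a surjection `e` from the fibres of some `X` onto `T`. Its kernel pair is a stable subset
of the fibres of `X ⨯ X`, hence a subobject `R`; as coequalisers are preserved, the coequaliser of
`R ⇉ X` has fibres `T`. -/
instance fibres_essSurj (hF : IsFibrewiseGalois F) : hF.fibres.EssSurj where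
  mem_essImage T := by
    have := hF.hasFiniteLimits
    have := hF.hasFiniteColimits
    have := hF.leftExact
    obtain ⟨X, e, he⟩ := hF.exists_surjection_fibres T
    obtain ⟨R, m, hm⟩ := hF.exists_subobject (Z := X ⨯ X)
      (fun j => {z | e.hom.app j ((F j).map prod.fst z) = e.hom.app j ((F j).map prod.snd z)})
      fun {i j} τ s hs => by
        change e.hom.app j ((F j).map prod.fst (τ.app _ s)) =
          e.hom.app j ((F j).map prod.snd (τ.app _ s))
        rw [← FunctorToFintypeCat.naturality, ← FunctorToFintypeCat.naturality]
        exact (FSets.naturality e (hF.path τ) _).trans ((congrArg (T.obj.map (hF.path τ)) hs).trans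
          (FSets.naturality e (hF.path τ) _).symm)
    let r₁ : R ⟶ X := m ≫ prod.fst
    let r₂ : R ⟶ X := m ≫ prod.snd
    let hl := isColimitOfHasCoequalizerOfPreservesColimit hF.fibres r₁ r₂
    have hc : hF.fibres.map r₁ ≫ e = hF.fibres.map r₂ ≫ e :=
        FSets.hom_ext fun (j : J) (r : (F j).obj R) => by
      have h : e.hom.app j ((F j).map prod.fst ((F j).map m r)) =
        e.hom.app j ((F j).map prod.snd ((F j).map m r)) := (hm j).2.le ⟨r, rfl⟩
      rwa [← map_comp_apply, ← map_comp_apply] at h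
    let d : hF.fibres.obj (coequalizer r₁ r₂) ⟶ T := hl.desc (Cofork.ofπ e hc)
    have hd : hF.fibres.map (coequalizer.π r₁ r₂) ≫ d = e :=
      hl.fac (Cofork.ofπ e hc) WalkingParallelPair.one
    have hd' (j) (x : (F j).obj X) :
        d.hom.app j ((F j).map (coequalizer.π r₁ r₂) x) = e.hom.app j x :=
      ConcreteCategory.congr_hom (congrArg (fibre hF.fundamentalGroupoid j).map hd) x
    have : IsIso d := (FSets.isIso_iff d).2 fun (j : J) => by
      have := hF.rightExact j
      refine ⟨fun a b hab => ?_, fun t => ?_⟩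
      · obtain ⟨x, rfl⟩ := surjective_of_epi (F j) (coequalizer.π r₁ r₂) a
        obtain ⟨y, rfl⟩ := surjective_of_epi (F j) (coequalizer.π r₁ r₂) b
        rw [hd', hd'] at hab
        obtain ⟨z, hz₁, hz₂⟩ := exists_mem_prod (F j) x y
        obtain ⟨r, rfl⟩ := (hm j).2.ge (show e.hom.app j ((F j).map prod.fst z) =
          e.hom.app j ((F j).map prod.snd z) by rw [hz₁, hz₂]; exact hab)
        have h : (F j).map (coequalizer.π r₁ r₂) ((F j).map r₁ r) =
            (F j).map (coequalizer.π r₁ r₂) ((F j).map r₂ r) := by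
          rw [← map_comp_apply, ← map_comp_apply, coequalizer.condition]
        rw [← hz₁, ← hz₂, ← map_comp_apply (F j) m, ← map_comp_apply (F j) m]
        exact h
      · obtain ⟨x, rfl⟩ := he j t
        exact ⟨_, hd' j x⟩
    exact ⟨_, ⟨asIso d⟩⟩

instance fibres_isEquivalence (hF : IsFibrewiseGalois F) : hF.fibres.IsEquivalence where

end IsFibrewiseGalois

end FinConnGalois

/-! ### The 2-equivalence -/

theorem FinConnGalois.IsFibrewiseGalois.comp_equivalence {C : Type v₁} [Category.{w₁} C]
    {D : Type v₂} [Category.{w₂} D] {J : Type u₁} {F : J → C ⥤ FintypeCat.{u}}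
    (hF : IsFibrewiseGalois F) (e : D ⥤ C) [e.IsEquivalence] :
    IsFibrewiseGalois fun j => e ⋙ F j where
  hasFiniteLimits :=
    have := hF.hasFiniteLimits
    ⟨fun _ => Adjunction.hasLimitsOfShape_of_equivalence e⟩
  hasFiniteColimits :=
    have := hF.hasFiniteColimits
    ⟨fun _ => Adjunction.hasColimitsOfShape_of_equivalence e⟩
  rightExact j :=
    have := hF.rightExact j
    comp_preservesFiniteColimits e (F j)
  leftExact j :=
    have := hF.leftExact j
    comp_preservesFiniteLimits e (F j)
  conservative := by
    obtain ⟨I, hI⟩ := hF.conservative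
    refine ⟨I, fun p hp => ?_⟩
    have : IsIso (e.map p) := hI _ hp
    exact isIso_of_reflects_iso p e
  factorisation {Y X} p := by
    obtain ⟨X', X'', p', p'', q, hp, H⟩ := hF.factorisation (e.map p)
    let a := e.objObjPreimageIso X'
    let b := e.objObjPreimageIso X''
    refine ⟨e.objPreimage X', e.objPreimage X'', e.preimage (p' ≫ a.inv),
      e.preimage (a.hom ≫ p''), e.preimage (b.hom ≫ q), e.map_injective ?_, fun j => ?_⟩
    · simp [hp]
    · have hrange {Z Z' : C} (c : Z ≅ Z') (r : Z' ⟶ e.obj X) :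
          Set.range ((F j).map (c.hom ≫ r)) = Set.range ((F j).map r) := by
        have : ⇑((F j).map (c.hom ≫ r)) = (F j).map r ∘ (F j).map c.hom :=
          funext fun z => map_comp_apply (F j) c.hom r z
        rw [this, (bijective_of_isIso (F j) c.hom).2.range_comp]
      have hinj {Z Z' : C} (c : Z ≅ Z') (r : Z' ⟶ e.obj X)
          (hr : Function.Injective ((F j).map r)) :
          Function.Injective ((F j).map (c.hom ≫ r)) := by
        have : ⇑((F j).map (c.hom ≫ r)) = (F j).map r ∘ (F j).map c.hom :=
          funext fun z => map_comp_apply (F j) c.hom r z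
        rw [this]
        exact hr.comp (bijective_of_isIso (F j) c.hom).1
      simp only [Functor.comp_map, Functor.map_preimage]
      refine ⟨?_, hinj a p'' (H j).2.1, hinj b q (H j).2.2.1, ?_⟩
      · have : ⇑((F j).map (p' ≫ a.inv)) = (F j).map a.inv ∘ (F j).map p' :=
          funext fun z => map_comp_apply (F j) p' a.inv z
        rw [this]
        exact (bijective_of_isIso (F j) a.inv).2.comp (H j).1
      · rw [hrange, hrange]
        exact (H j).2.2.2

/-- An equivalence of categories compatible with the fibre functors is an equivalence in `GCat`. -/
def GCat.equivalenceOfEquivalence {X Y : GCat.{u}} (E : X.C ≌ Y.C) (f : Y.J → X.J) (g : X.J → Y.J)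
    (lam : ∀ j, X.F (f j) ≅ E.functor ⋙ Y.F j) (lam' : ∀ j, Y.F (g j) ≅ E.inverse ⋙ X.F j) :
    Bicategory.Equivalence X Y :=
  let p : GCat.Hom X Y := ⟨f, E.functor, inferInstance, inferInstance, lam⟩
  let q : GCat.Hom Y X := ⟨g, E.inverse, inferInstance, inferInstance, lam'⟩
  Bicategory.Equivalence.mkOfAdjointifyCounit (f := p) (g := q)
    (GCat.isoOfNatIso (p := GCat.Hom.id X) (q := p.comp q) E.unitIso)
    (GCat.isoOfNatIso (p := q.comp p) (q := GCat.Hom.id Y) E.counitIso)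

/-- The fundamental groupoid is formed from a small model of the category, so that its hom-sets lie
in the right universe. The index set of fibre functors is unchanged. -/
theorem ProfGrpd.exists_equivalence_toGCat (X : GCat.{u}) :
    ∃ 𝔊 : ProfGrpd.{u}, Nonempty (Bicategory.Equivalence (toGCat 𝔊 (fSetsIsGalois 𝔊)) X) := by
  have := X.essentiallySmall
  let e := equivSmallModel.{u} X.C
  have hF := X.isGalois.isFibrewiseGalois.comp_equivalence e.inverse
  let E : FSets hF.fundamentalGroupoid ≌ X.C := (e.trans hF.fibres.asEquivalence).symm
  let lam (j : X.J) : X.F j ≅ E.inverse ⋙ fibre hF.fundamentalGroupoid (hF.pt j) :=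
    Functor.isoWhiskerRight e.unitIso (X.F j)
  let lam' (j : X.J) : fibre hF.fundamentalGroupoid (hF.pt j) ≅ E.functor ⋙ X.F j :=
    Functor.isoWhiskerRight E.unitIso (fibre hF.fundamentalGroupoid (hF.pt j)) ≪≫
      Functor.isoWhiskerLeft E.functor (lam j).symm
  exact ⟨hF.fundamentalGroupoid, ⟨GCat.equivalenceOfEquivalence
    (X := toGCat hF.fundamentalGroupoid (fSetsIsGalois _)) (Y := X) E hF.pt (fun j => j) lam' lam⟩⟩

end

theorem mainTheorem3 :
    ∃ (hobj : ∀ 𝔊 : ProfGrpd.{u}, ProfGrpd.FSetsIsGalois 𝔊)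
      (hmap : ∀ {𝔊 ℌ : ProfGrpd.{u}} (A : 𝔊 ⟶ ℌ), ProfGrpd.RestrictIsExact A),
      (ProfGrpd.fSetsPseudofunctor hobj hmap).IsTwoEquivalence :=
  ⟨ProfGrpd.fSetsIsGalois, ProfGrpd.restrictIsExact,
    { essSurj := fun X => by
        obtain ⟨𝔊, h⟩ := ProfGrpd.exists_equivalence_toGCat X
        exact ⟨Opposite.op 𝔊, h⟩
      fullyFaithful := ProfGrpd.fSetsPseudofunctor_mapFunctor_isEquivalence _ _ }⟩
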